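/- Let $k$ be a field of characteristic $0$ and let $X=GM$ be a finite group factorization: $G,M\le X$ are subgroups of a finite group such that $G\times M\to X$, $(u,s)\mapsto us$, is bijective. For $s\in M$, $u\in G$ write $su=(s\triangleright u)(s\triangleleft u)$ with $s\triangleright u\in G$, $s\triangleleft u\in M$. Let $A=k(M)\blacktriangleright\!\!\!\triangleleft\, kG$ be the bicrossproduct Hopf algebra: it has basis $\delta_s\otimes u$ ($s\in M$, $u\in G$), with $$(\delta_s\otimes u)(\delta_t\otimes v)=\delta_{s\triangleleft u,t}\,\delta_s\otimes uv,\quad \Delta(\delta_s\otimes u)=\sum_{ab=s}(\delta_a\otimes b\triangleright u)\otimes(\delta_b\otimes u),\quad 1=\sum_s\delta_s\otimes e,$$ $$\varepsilon(\delta_s\otimes u)=\delta_{s,e},\qquad S(\delta_s\otimes u)=\delta_{(s\triangleleft u)^{-1}}\otimes(s\triangleright u)^{-1}.$$ Let $H=A^*$, with dual basis $t\otimes\delta_v$, and $H^+=\{\varphi\in H:\varphi(1)=0\}$. Give $kX$ the $X$-grading and the right action of $X$ in which, for $v,u\in G$ and $t,s\in M$, $$\|vt\|=v^{-1}t^{-1}v,\qquad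 vt\,\tilde\triangleleft\,us=(\tilde s\triangleright vu)(\tilde s t\tilde s^{-1}),\quad \tilde s=s^{-1}\triangleleft(vu)^{-1},$$ and let $\Pi:kX\to H^+$, $\Pi(vt)=t\otimes\delta_v-\delta_{v,e}1$. For $z\in X$ let $J_z\subset kX$ be the span of the $x\in X$ with $\|x\|=z$. A *classification datum* is a pair $(z_0,\mathcal M_0)$ with $z_0\in X$ and $\mathcal M_0\subset J_{z_0}$ an irreducible (nonzero) subrepresentation of the centralizer of $z_0$ in $X$; put $\mathcal M=\sum_{y\in X}\mathcal M_0\,\tilde\triangleleft\, y$. For homogeneous $w\in kX$ of degree $z$ let $\langle w\rangle\in M$ be defined by $z=\langle w\rangle^{-1}|w|$ with $|w|\in G$. Let $(\Omega^1,d)$ be a bicovariant first order differential calculus on $A$ which is irreducible, i.e. $\Omega^1\ne0$ and its only sub-bimodules that are also sub-bicomodules are $0$ and $\Omega^1$. Let $\Lambda^1\subset\Omega^1$ be the space of left-invariant 1-forms, $\omega(a)=\sum S(a_{(1)})\,da_{(2)}\in\Lambda^1$ for $a\in A$, and let $$L=\{\varphi\in H^+:\ \varphi(a)=0\ \text{whenever}\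 \varepsilon(a)=0\ \text{and}\ \omega(a)=0\}$$ be the quantum tangent space, which is paired with $\Lambda^1$ by $\langle\omega(a),\varphi\rangle=\varphi(a)$. Then: 1. There is a classification datum $(z_0,\mathcal M_0)$ with $\Pi(\mathcal M)=L$. 2. For every classification datum $(z_0,\mathcal M_0)$ with $\Pi(\mathcal M)=L$: (a) if $(f_i)$ is a basis of $\mathcal M_0$ and for each conjugate $z$ of $z_0$ an element $\bar z\in X$ with $z=\bar z^{-1}z_0\bar z$ is chosen, then the vectors $f_{iz}=f_i\,\tilde\triangleleft\,\bar z$ form a basis of $\mathcal M$, with $f_{iz}$ homogeneous of degree $z$; (b) for every basis $(f_a)_{a\in I}$ of $\mathcal M$ consisting of homogeneous vectors there is a basis $(e_a)_{a\in I}$ of $\Lambda^1$ dual to $(\Pi(f_a))_{a\in I}$, i.e. with $\omega(x)=\sum_a\langle x,\Pi(f_a)\rangle e_a$ for all $x\in A$, and for every such dual basis the calculus is inner: $$dx=[\theta,x]=\theta x-x\theta\quad\text{for all }x\in A,\qquad \theta=\sum_{a\in I}c_ae_a,\quad c_a=\langle\delta_{\langle f_a\rangle},f_a\rangle,$$ where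 $c_a$ is the coefficient in $f_a\in kX$ of the element $\langle f_a\rangle\in M\subset X$. -/

import Mathlib

open scoped TensorProduct

noncomputable section

section Factorization

open scoped Classical

variable {X : Type*} [Group X] {G M : Subgroup X}

namespace Bicross

/-! ### The matched pair of a group factorization `X = GM`

`h : G.IsComplement' M` says that the product `G × M → X` is bijective. -/

/-- The factor `u ∈ G` of `x = us`. -/
def gFactor (h : G.IsComplement' M) (x : X) : G := (h.equiv x).1

/-- The factor `s ∈ M` of `x = us`. -/
def mFactor (h : G.IsComplement' M) (x : X) : M := (h.equiv x).2

/-- The left action `s ▷ u` of `M` on the set `G`, where `su = (s ▷ u)(s ◁ u)`. -/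
def lact (h : G.IsComplement' M) (s : M) (u : G) : G := gFactor h ((s : X) * u)

/-- The right action `s ◁ u` of `G` on the set `M`, where `su = (s ▷ u)(s ◁ u)`. -/
def ract (h : G.IsComplement' M) (s : M) (u : G) : M := mFactor h ((s : X) * u)

variable (h : G.IsComplement' M)

theorem factor_mul (x : X) : (gFactor h x : X) * (mFactor h x : X) = x :=
  h.equiv_fst_mul_equiv_snd x

theorem gFactor_mul (u : G) (s : M) : gFactor h ((u : X) * s) = u := by
  have := h.equiv.apply_symm_apply (u, s)
  exact congrArg Prod.fst this

theorem mFactor_mul (u : G) (s : M) : mFactor h ((u : X) * s) = s := by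
  have := h.equiv.apply_symm_apply (u, s)
  exact congrArg Prod.snd this

theorem lact_mul_ract (s : M) (u : G) : (lact h s u : X) * (ract h s u : X) = s * u :=
  factor_mul h _

theorem act_unique {s t : M} {u v : G} (e : (s : X) * u = v * t) :
    lact h s u = v ∧ ract h s u = t := by
  unfold lact ract
  rw [e]
  exact ⟨gFactor_mul h v t, mFactor_mul h v t⟩

theorem act_one (s : M) : lact h s 1 = 1 ∧ ract h s 1 = s := act_unique h (by simp)

theorem one_act (u : G) : lact h 1 u = u ∧ ract h 1 u = 1 := act_unique h (by simp)

theorem act_mul (s : M) (u v : G) :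
    lact h s (u * v) = lact h s u * lact h (ract h s u) v ∧
      ract h s (u * v) = ract h (ract h s u) v := by
  apply act_unique
  push_cast
  rw [mul_assoc, lact_mul_ract, ← mul_assoc, ← mul_assoc, lact_mul_ract]

theorem mul_act (s t : M) (u : G) :
    lact h (s * t) u = lact h s (lact h t u) ∧
      ract h (s * t) u = ract h s (lact h t u) * ract h t u := by
  apply act_unique
  push_cast
  rw [← mul_assoc, lact_mul_ract, mul_assoc, mul_assoc, lact_mul_ract]

theorem inv_act (s : M) (u : G) :
    lact h (ract h s u)⁻¹ (lact h s u)⁻¹ = u⁻¹ ∧ ract h (ract h s u)⁻¹ (lact h s u)⁻¹ = s⁻¹ := by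
  apply act_unique
  push_cast
  rw [← mul_inv_rev, ← mul_inv_rev, lact_mul_ract]

theorem lact_inj {s : M} {u v : G} (e : lact h s u = lact h s v) : u = v := by
  have := congrArg (lact h s⁻¹) e
  simpa [← (mul_act h _ _ _).1, (one_act h _).1] using this

theorem ract_inj {s t : M} {u : G} (e : ract h s u = ract h t u) : s = t := by
  have := congrArg (fun x => ract h x u⁻¹) e
  simpa [← (act_mul h _ _ _).2, (act_one h _).2] using this

end Bicross

/-! ### The bicrossproduct Hopf algebra `A = k(M) ▶◁ kG` -/

/-- The vector space of the bicrossproduct, with basis `δ_s ⊗ u` for `s ∈ M`, `u ∈ G`. -/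
def Bicrossproduct (k : Type*) [Field k] {X : Type*} [Group X] {G M : Subgroup X}
    (_ : G.IsComplement' M) : Type _ := (M × G) →₀ k

namespace Bicrossproduct

open Bicross

variable {k : Type*} [Field k] {h : G.IsComplement' M}

instance : AddCommGroup (Bicrossproduct k h) := inferInstanceAs (AddCommGroup ((M × G) →₀ k))

instance : Module k (Bicrossproduct k h) := inferInstanceAs (Module k ((M × G) →₀ k))

/-- The linear map with prescribed values on the basis elements `δ_s ⊗ u`. -/
def lift {N : Type*} [AddCommGroup N] [Module k N] (f : M → G → N) :
    Bicrossproduct k h →ₗ[k] N :=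
  Finsupp.linearCombination k (fun p : M × G => f p.1 p.2)

/-- The basis element `δ_s ⊗ u`. -/
def delta (s : M) (u : G) : Bicrossproduct k h := Finsupp.single (s, u) (1 : k)

/-- The coefficient of `δ_s ⊗ u`; in the dual Hopf algebra this is the element `s ⊗ δ_u`. -/
def coeff (s : M) (u : G) : Bicrossproduct k h →ₗ[k] k := Finsupp.lapply (s, u)

@[simp] theorem lift_delta {N : Type*} [AddCommGroup N] [Module k N] (f : M → G → N)
    (s : M) (u : G) : lift f (delta s u : Bicrossproduct k h) = f s u :=
  (Finsupp.linearCombination_single k (1 : k) (s, u)).trans (one_smul k _)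

theorem coeff_delta (s t : M) (u v : G) :
    coeff s u (delta t v : Bicrossproduct k h) = if t = s ∧ v = u then 1 else 0 := by
  refine (Finsupp.single_apply (a := (t, v)) (a' := (s, u)) (b := (1 : k))).trans ?_
  simp only [Prod.mk.injEq]

theorem ind {p : Bicrossproduct k h → Prop} (hd : ∀ s u, p (delta s u))
    (ha : ∀ a b, p a → p b → p (a + b)) (hs : ∀ (c : k) a, p a → p (c • a))
    (a : Bicrossproduct k h) : p a := by
  refine Finsupp.induction_linear (motive := p) a ?_ ha ?_
  · have := hs 0 _ (hd 1 1)
    rwa [zero_smul] at this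
  · rintro ⟨s, u⟩ c
    have := hs c _ (hd s u)
    have e : (c • delta s u : Bicrossproduct k h) = (Finsupp.single (s, u) c : (M × G) →₀ k) :=
      Finsupp.smul_single_one (s, u) c
    rwa [e] at this

theorem hom_ext {N : Type*} [AddCommGroup N] [Module k N] {f g : Bicrossproduct k h →ₗ[k] N}
    (e : ∀ s u, f (delta s u) = g (delta s u)) : f = g := by
  ext1 a
  induction a using ind with
  | hd s u => exact e s u
  | ha a b ha hb => rw [map_add, map_add, ha, hb]
  | hs c a ha => rw [map_smul, map_smul, ha]

/-- `(δ_s ⊗ u)(δ_t ⊗ v) = δ_{s ◁ u, t} (δ_s ⊗ uv)`. -/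
def mulMap : Bicrossproduct k h →ₗ[k] Bicrossproduct k h →ₗ[k] Bicrossproduct k h :=
  lift fun s u => lift fun t v => if ract h s u = t then delta s (u * v) else 0

instance : Mul (Bicrossproduct k h) := ⟨fun a b => mulMap a b⟩

theorem delta_mul_delta (s t : M) (u v : G) :
    (delta s u * delta t v : Bicrossproduct k h) =
      if ract h s u = t then delta s (u * v) else 0 := by
  change mulMap _ _ = _
  simp [mulMap]

theorem add_mul' (a b c : Bicrossproduct k h) : (a + b) * c = a * c + b * c :=
  LinearMap.map_add₂ mulMap a b c

theorem mul_add' (a b c : Bicrossproduct k h) : a * (b + c) = a * b + a * c :=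
  map_add (mulMap a) b c

theorem smul_mul' (r : k) (a b : Bicrossproduct k h) : (r • a) * b = r • (a * b) :=
  LinearMap.map_smul₂ mulMap r a b

theorem mul_smul' (r : k) (a b : Bicrossproduct k h) : a * (r • b) = r • (a * b) :=
  map_smul (mulMap a) r b

theorem zero_mul' (a : Bicrossproduct k h) : 0 * a = 0 := LinearMap.map_zero₂ mulMap a

theorem mul_zero' (a : Bicrossproduct k h) : a * 0 = 0 := map_zero (mulMap a)

theorem sum_mul' {ι : Type*} (t : Finset ι) (f : ι → Bicrossproduct k h)
    (b : Bicrossproduct k h) : (∑ i ∈ t, f i) * b = ∑ i ∈ t, f i * b :=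
  map_sum (mulMap.flip b) f t

theorem mul_sum' {ι : Type*} (t : Finset ι) (f : ι → Bicrossproduct k h)
    (b : Bicrossproduct k h) : b * (∑ i ∈ t, f i) = ∑ i ∈ t, b * f i :=
  map_sum (mulMap b) f t

theorem mul_assoc' (a b c : Bicrossproduct k h) : a * b * c = a * (b * c) := by
  induction a using ind with
  | ha a b ha hb => simp only [add_mul', ha, hb]
  | hs c a ha => simp only [smul_mul', ha]
  | hd s u =>
  induction b using ind with
  | ha a b ha hb => simp only [add_mul', mul_add', ha, hb]
  | hs c a ha => simp only [smul_mul', mul_smul', ha]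
  | hd t v =>
  induction c using ind with
  | ha a b ha hb => simp only [mul_add', ha, hb]
  | hs c a ha => simp only [mul_smul', ha]
  | hd r w =>
    rw [delta_mul_delta, delta_mul_delta]
    by_cases e1 : ract h s u = t
    · subst e1
      by_cases e2 : ract h (ract h s u) v = r
      · simp [delta_mul_delta, e2, (act_mul h _ _ _).2, mul_assoc]
      · simp [delta_mul_delta, e2, (act_mul h _ _ _).2, mul_zero']
    · by_cases e2 : ract h t v = r
      · simp [delta_mul_delta, e1, e2, zero_mul']
      · simp [e1, e2, zero_mul', mul_zero']

variable [Fintype M]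

/-- `1 = ∑ₛ δ_s ⊗ e`. -/
instance : One (Bicrossproduct k h) := ⟨∑ s : M, delta s 1⟩

theorem one_def : (1 : Bicrossproduct k h) = ∑ s : M, delta s 1 := rfl

theorem one_mul' (a : Bicrossproduct k h) : 1 * a = a := by
  induction a using ind with
  | hd s u => simp [one_def, sum_mul', delta_mul_delta, (act_one h _).2]
  | ha a b ha hb => rw [mul_add', ha, hb]
  | hs c a ha => rw [mul_smul', ha]

theorem mul_one' (a : Bicrossproduct k h) : a * 1 = a := by
  induction a using ind with
  | hd s u => simp [one_def, mul_sum', delta_mul_delta]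
  | ha a b ha hb => rw [add_mul', ha, hb]
  | hs c a ha => rw [smul_mul', ha]

instance : Ring (Bicrossproduct k h) :=
  { (inferInstance : AddCommGroup (Bicrossproduct k h)) with
    mul := (· * ·)
    one := 1
    left_distrib := mul_add'
    right_distrib := add_mul'
    zero_mul := zero_mul'
    mul_zero := mul_zero'
    mul_assoc := mul_assoc'
    one_mul := one_mul'
    mul_one := mul_one' }

instance : Algebra k (Bicrossproduct k h) := Algebra.ofModule smul_mul' mul_smul'

/-- `Δ(δ_s ⊗ u) = ∑_{ab = s} (δ_a ⊗ b ▷ u) ⊗ (δ_b ⊗ u)` and `ε(δ_s ⊗ u) = δ_{s,e}`. -/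
instance : CoalgebraStruct k (Bicrossproduct k h) where
  comul := lift fun s u => ∑ b : M, delta (s * b⁻¹) (lact h b u) ⊗ₜ[k] delta b u
  counit := lift fun s _ => if s = 1 then 1 else 0

theorem comul_delta (s : M) (u : G) :
    CoalgebraStruct.comul (R := k) (delta s u : Bicrossproduct k h) =
      ∑ b : M, delta (s * b⁻¹) (lact h b u) ⊗ₜ[k] delta b u := lift_delta _ _ _

theorem counit_delta (s : M) (u : G) :
    CoalgebraStruct.counit (R := k) (delta s u : Bicrossproduct k h) = if s = 1 then 1 else 0 :=
  lift_delta _ _ _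

instance : Coalgebra k (Bicrossproduct k h) where
  coassoc := by
    apply hom_ext
    intro s u
    simp only [LinearMap.comp_apply, LinearEquiv.coe_coe, comul_delta, map_sum,
      LinearMap.rTensor_tmul, LinearMap.lTensor_tmul, TensorProduct.sum_tmul,
      TensorProduct.tmul_sum, TensorProduct.assoc_tmul]
    conv_rhs => rw [Finset.sum_comm]
    refine Finset.sum_congr rfl fun c _ => ?_
    refine Fintype.sum_equiv (Equiv.mulRight c) _ _ fun b => ?_
    simp [(mul_act h _ _ _).1, mul_assoc]
  rTensor_counit_comp_comul := by
    apply hom_ext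
    intro s u
    simp only [LinearMap.comp_apply, comul_delta, map_sum, LinearMap.rTensor_tmul, counit_delta,
      TensorProduct.mk_apply]
    rw [Finset.sum_eq_single s]
    · simp
    · intro b _ hb
      rw [if_neg (fun e => hb (mul_inv_eq_one.mp e).symm), TensorProduct.zero_tmul]
    · simp
  lTensor_counit_comp_comul := by
    apply hom_ext
    intro s u
    simp only [LinearMap.comp_apply, comul_delta, map_sum, LinearMap.lTensor_tmul, counit_delta,
      LinearMap.flip_apply, TensorProduct.mk_apply]
    rw [Finset.sum_eq_single 1]
    · simp [(one_act h _).1]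
    · intro b _ hb
      rw [if_neg hb, TensorProduct.tmul_zero]
    · simp

theorem counit_mul' (a b : Bicrossproduct k h) :
    Coalgebra.counit (R := k) (a * b) = Coalgebra.counit (R := k) a * Coalgebra.counit b := by
  induction a using ind with
  | ha a b ha hb => simp only [add_mul, map_add, ha, hb]
  | hs c a ha => simp only [smul_mul_assoc, map_smul, ha, smul_eq_mul, mul_assoc]
  | hd s u =>
  induction b using ind with
  | ha a b ha hb => simp only [mul_add, map_add, ha, hb]
  | hs c a ha => simp only [mul_smul_comm, map_smul, ha, smul_eq_mul, mul_left_comm]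
  | hd t v =>
    rw [delta_mul_delta, counit_delta, counit_delta]
    by_cases hs : s = 1
    · subst hs
      by_cases ht : t = 1
      · simp [ht, (one_act h _).2, counit_delta]
      · simp [ht, (one_act h _).2, Ne.symm ht]
    · split_ifs <;> simp [counit_delta, hs]

theorem comul_one' :
    Coalgebra.comul (R := k) (1 : Bicrossproduct k h) = 1 := by
  rw [Algebra.TensorProduct.one_def, one_def, map_sum]
  simp only [comul_delta, (act_one h _).1, TensorProduct.sum_tmul, TensorProduct.tmul_sum]
  rw [Finset.sum_comm]
  exact Finset.sum_congr rfl fun b _ => Fintype.sum_equiv (Equiv.mulRight b⁻¹) _ _ fun s => by simp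

theorem comul_mul' (a b : Bicrossproduct k h) :
    Coalgebra.comul (R := k) (a * b) = Coalgebra.comul (R := k) a * Coalgebra.comul b := by
  induction a using ind with
  | ha a b ha hb => simp only [add_mul, map_add, ha, hb]
  | hs c a ha => simp only [smul_mul_assoc, map_smul, ha]
  | hd s u =>
  induction b using ind with
  | ha a b ha hb => simp only [mul_add, map_add, ha, hb]
  | hs c a ha => simp only [mul_smul_comm, map_smul, ha]
  | hd t v =>
    rw [delta_mul_delta, comul_delta, comul_delta, Finset.sum_mul_sum]
    have key : ∀ b c : M,
        (delta (s * b⁻¹) (lact h b u) ⊗ₜ[k] delta b u) *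
          (delta (t * c⁻¹) (lact h c v) ⊗ₜ[k] delta c v) =
        if ract h b u = c then (if ract h s u = t then
          (delta (s * b⁻¹) (lact h b (u * v)) ⊗ₜ[k] delta b (u * v) :
            Bicrossproduct k h ⊗[k] Bicrossproduct k h) else 0) else 0 := by
      intro b c
      rw [Algebra.TensorProduct.tmul_mul_tmul, delta_mul_delta, delta_mul_delta]
      by_cases e : ract h b u = c
      · subst e
        have : (ract h (s * b⁻¹) (lact h b u) = t * (ract h b u)⁻¹) ↔ ract h s u = t := by
          rw [eq_mul_inv_iff_mul_eq, ← (mul_act h _ _ _).2, inv_mul_cancel_right]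
        simp only [this, if_true]
        split_ifs
        · rw [(act_mul h _ _ _).1]
        · simp
      · simp [e]
    simp only [key, Finset.sum_ite_eq, Finset.mem_univ, if_true]
    split_ifs
    · rw [comul_delta]
    · simp

instance : Bialgebra k (Bicrossproduct k h) :=
  Bialgebra.mk' k (Bicrossproduct k h)
    (by
      change Coalgebra.counit (R := k) (1 : Bicrossproduct k h) = 1
      simp [one_def, map_sum, counit_delta])
    (counit_mul' _ _) comul_one' (comul_mul' _ _)

/-- `S(δ_s ⊗ u) = δ_{(s ◁ u)⁻¹} ⊗ (s ▷ u)⁻¹`. -/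
instance : HopfAlgebraStruct k (Bicrossproduct k h) where
  antipode := lift fun s u => delta (ract h s u)⁻¹ (lact h s u)⁻¹

theorem antipode_delta (s : M) (u : G) :
    HopfAlgebra.antipode k (delta s u : Bicrossproduct k h) =
      delta (ract h s u)⁻¹ (lact h s u)⁻¹ := lift_delta _ _ _

instance : HopfAlgebra k (Bicrossproduct k h) where
  mul_antipode_rTensor_comul := by
    apply hom_ext
    intro s u
    simp only [LinearMap.comp_apply, comul_delta, map_sum, LinearMap.rTensor_tmul,
      LinearMap.mul'_apply, counit_delta, Algebra.linearMap_apply]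
    have key : ∀ b : M,
        delta (ract h (s * b⁻¹) (lact h b u))⁻¹ (lact h (s * b⁻¹) (lact h b u))⁻¹ * delta b u =
          if s = 1 then (delta (ract h b u) 1 : Bicrossproduct k h) else 0 := by
      intro b
      have e1 : lact h (s * b⁻¹) (lact h b u) = lact h s u := by
        rw [← (mul_act h _ _ _).1, inv_mul_cancel_right]
      have e2 : (ract h (s * b⁻¹) (lact h b u))⁻¹ = ract h b u * (ract h s u)⁻¹ := by
        rw [inv_eq_iff_eq_inv, mul_inv_rev, inv_inv, eq_mul_inv_iff_mul_eq, ← (mul_act h _ _ _).2,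
          inv_mul_cancel_right]
      have e3 : ract h (ract h b u * (ract h s u)⁻¹) (lact h s u)⁻¹ = b * s⁻¹ := by
        rw [(mul_act h _ _ _).2, (inv_act h s u).1, (inv_act h s u).2, ← (act_mul h _ _ _).2,
          mul_inv_cancel, (act_one h _).2]
      rw [e1, e2, delta_mul_delta, e3]
      by_cases hs : s = 1
      · subst hs
        simp [(one_act h _).1, (one_act h _).2]
      · simp [hs]
    simp only [antipode_delta, key]
    by_cases hs : s = 1
    · simp only [hs, if_true, map_one, one_def]
      exact Fintype.sum_bijective (fun b => ract h b u)
        (Finite.injective_iff_bijective.mp fun _ _ e => ract_inj h e) _ _ fun _ => rfl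
    · simp [hs]
  mul_antipode_lTensor_comul := by
    apply hom_ext
    intro s u
    simp only [LinearMap.comp_apply, comul_delta, map_sum, LinearMap.lTensor_tmul,
      LinearMap.mul'_apply, counit_delta, Algebra.linearMap_apply]
    have key : ∀ b : M,
        delta (s * b⁻¹) (lact h b u) * delta (ract h b u)⁻¹ (lact h b u)⁻¹ =
          if s = 1 then (delta b⁻¹ 1 : Bicrossproduct k h) else 0 := by
      intro b
      have e1 : ract h (s * b⁻¹) (lact h b u) = (ract h b u)⁻¹ ↔ s = 1 := by
        rw [eq_inv_iff_mul_eq_one, ← (mul_act h _ _ _).2, inv_mul_cancel_right]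
        constructor
        · intro e
          exact ract_inj h (u := u) (e.trans (one_act h u).2.symm)
        · rintro rfl
          exact (one_act h u).2
      rw [delta_mul_delta]
      simp only [e1, mul_inv_cancel]
      by_cases hs : s = 1
      · simp [hs]
      · simp [hs]
    simp only [antipode_delta, key]
    by_cases hs : s = 1
    · simp only [hs, if_true, map_one, one_def]
      exact Fintype.sum_equiv (Equiv.inv M) _ _ fun _ => rfl
    · simp [hs]

end Bicrossproduct

end Factorization

section Calculus

/-! ### Bicovariant first order differential calculi on a Hopf algebra -/

/-- Left multiplication of a bimodule of forms, as a bilinear map. -/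
def leftMulForm (k A Ω : Type*) [Field k] [Ring A] [Algebra k A] [AddCommGroup Ω] [Module k Ω]
    [Module A Ω] [IsScalarTower k A Ω] : A →ₗ[k] Ω →ₗ[k] Ω :=
  LinearMap.mk₂ k (fun a η => a • η) (fun a b η => add_smul a b η)
    (fun c a η => smul_assoc c a η) (fun a η ζ => smul_add a η ζ)
    (fun c a η => smul_comm a c η)

/-- Right multiplication of a bimodule of forms, as a bilinear map. -/
def rightMulForm (k A Ω : Type*) [Field k] [Ring A] [Algebra k A] [AddCommGroup Ω] [Module k Ω]
    [Module Aᵐᵒᵖ Ω] [IsScalarTower k Aᵐᵒᵖ Ω] : A →ₗ[k] Ω →ₗ[k] Ω :=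
  LinearMap.mk₂ k (fun a η => MulOpposite.op a • η)
    (fun a b η => by rw [MulOpposite.op_add, add_smul])
    (fun c a η => by rw [MulOpposite.op_smul, smul_assoc])
    (fun a η ζ => smul_add _ η ζ) (fun c a η => smul_comm _ c η)

/-- A bicovariant first order differential calculus over the bialgebra `A` with bimodule of
1-forms `Ω`: the right multiplication `η · a` is written `MulOpposite.op a • η`. -/
structure BicovariantCalculus (k A Ω : Type*) [Field k] [Ring A] [Bialgebra k A]
    [AddCommGroup Ω] [Module k Ω] [Module A Ω] [Module Aᵐᵒᵖ Ω] [SMulCommClass A Aᵐᵒᵖ Ω]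
    [IsScalarTower k A Ω] [IsScalarTower k Aᵐᵒᵖ Ω] where
  /-- the exterior derivative -/
  d : A →ₗ[k] Ω
  leibniz : ∀ a b : A, d (a * b) = a • d b + MulOpposite.op b • d a
  /-- the map `A ⊗ A → Ω`, `a ⊗ b ↦ a db` is surjective -/
  surjective : Submodule.span k {η : Ω | ∃ a b : A, η = a • d b} = ⊤
  /-- the left coaction -/
  coactL : Ω →ₗ[k] A ⊗[k] Ω
  /-- the right coaction -/
  coactR : Ω →ₗ[k] Ω ⊗[k] A
  coactL_coassoc : ∀ η, TensorProduct.assoc k A A Ω (Coalgebra.comul.rTensor Ω (coactL η)) =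
    coactL.lTensor A (coactL η)
  coactL_counit : ∀ η, (Coalgebra.counit (R := k) (A := A)).rTensor Ω (coactL η) = 1 ⊗ₜ[k] η
  coactR_coassoc : ∀ η, TensorProduct.assoc k Ω A A (coactR.rTensor A (coactR η)) =
    Coalgebra.comul.lTensor Ω (coactR η)
  coactR_counit : ∀ η, (Coalgebra.counit (R := k) (A := A)).lTensor Ω (coactR η) = η ⊗ₜ[k] 1
  /-- the two coactions commute -/
  coact_comm : ∀ η, TensorProduct.assoc k A Ω A (coactL.rTensor A (coactR η)) =
    coactR.lTensor A (coactL η)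
  /-- the coactions are bimodule maps, `A` acting on tensor products through the coproduct -/
  coactL_left : ∀ a η, coactL (a • η) =
    TensorProduct.map₂ (LinearMap.mul k A) (leftMulForm k A Ω) (Coalgebra.comul a) (coactL η)
  coactL_right : ∀ a η, coactL (MulOpposite.op a • η) =
    TensorProduct.map₂ (LinearMap.mul k A).flip (rightMulForm k A Ω) (Coalgebra.comul a) (coactL η)
  coactR_left : ∀ a η, coactR (a • η) =
    TensorProduct.map₂ (leftMulForm k A Ω) (LinearMap.mul k A) (Coalgebra.comul a) (coactR η)
  coactR_right : ∀ a η, coactR (MulOpposite.op a • η) =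
    TensorProduct.map₂ (rightMulForm k A Ω) (LinearMap.mul k A).flip (Coalgebra.comul a) (coactR η)
  /-- the exterior derivative is a bicomodule map -/
  coactL_d : ∀ a, coactL (d a) = d.lTensor A (Coalgebra.comul a)
  coactR_d : ∀ a, coactR (d a) = d.rTensor A (Coalgebra.comul a)

namespace BicovariantCalculus

variable {k A Ω : Type*} [Field k] [Ring A] [HopfAlgebra k A]
  [AddCommGroup Ω] [Module k Ω] [Module A Ω] [Module Aᵐᵒᵖ Ω] [SMulCommClass A Aᵐᵒᵖ Ω]
  [IsScalarTower k A Ω] [IsScalarTower k Aᵐᵒᵖ Ω]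

/-- The calculus is nonzero and has no proper quotients: its only sub-bimodules that are also
sub-bicomodules are `0` and `Ω`. -/
def IsIrreducible (Γ : BicovariantCalculus k A Ω) : Prop :=
  Nontrivial Ω ∧ ∀ N : Submodule k Ω,
    (∀ (a : A), ∀ η ∈ N, a • η ∈ N ∧ MulOpposite.op a • η ∈ N) →
    (∀ η ∈ N, Γ.coactL η ∈ LinearMap.range (N.subtype.lTensor A) ∧
      Γ.coactR η ∈ LinearMap.range (N.subtype.rTensor A)) →
    N = ⊥ ∨ N = ⊤

/-- The space `Λ¹` of left-invariant 1-forms. -/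
def leftInvariant (Γ : BicovariantCalculus k A Ω) : Submodule k Ω :=
  LinearMap.ker (Γ.coactL - TensorProduct.mk k A Ω 1)

/-- The projection `ω(a) = ∑ S(a₍₁₎) da₍₂₎` of `A` onto the left-invariant 1-forms; thus
`da = ∑ a₍₁₎ ω(a₍₂₎)`. -/
def maurerCartan (Γ : BicovariantCalculus k A Ω) : A →ₗ[k] Ω :=
  TensorProduct.lift (leftMulForm k A Ω) ∘ₗ
    TensorProduct.map (HopfAlgebra.antipode k) Γ.d ∘ₗ Coalgebra.comul

/-- The quantum tangent space `L ⊂ H⁺`, where `H` is the dual of `A`: the functionals on `A` that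
vanish at `1` and on all `a ∈ A⁺ = ker ε` with `ω(a) = 0`. It is dual to `Λ¹` through
`⟨ω(a), φ⟩ = φ(a)`. -/
def tangentSpace (Γ : BicovariantCalculus k A Ω) : Submodule k (Module.Dual k A) where
  carrier := {φ | φ 1 = 0 ∧
    ∀ a : A, Coalgebra.counit (R := k) a = 0 → Γ.maurerCartan a = 0 → φ a = 0}
  add_mem' := by
    rintro φ ψ ⟨h1, h2⟩ ⟨h3, h4⟩
    exact ⟨by simp [h1, h3], fun a ha hm => by simp [h2 a ha hm, h4 a ha hm]⟩
  zero_mem' := by simp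
  smul_mem' := by
    rintro c φ ⟨h1, h2⟩
    exact ⟨by simp [h1], fun a ha hm => by simp [h2 a ha hm]⟩

/-- `e` is a basis of `Λ¹`, dual to the family `φ` of tangent vectors: the coordinates of the
1-form `ω(x)` in the basis `e` are the values `⟨ω(x), φ_a⟩ = φ_a(x)`. -/
structure IsDualBasis (Γ : BicovariantCalculus k A Ω) {ι : Type*} [Fintype ι]
    (φ : ι → Module.Dual k A) (e : ι → Ω) : Prop where
  linearIndependent : LinearIndependent k e
  span_eq : Submodule.span k (Set.range e) = Γ.leftInvariant
  dual : ∀ x : A, Γ.maurerCartan x = ∑ a, φ a x • e a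

end BicovariantCalculus

end Calculus

section CrossedModule

/-! ### The canonical `X`-crossed module `kX` and the classification data -/

namespace Bicross

variable {X : Type*} [Group X] {G M : Subgroup X}

/-- The degree `‖vt‖ = v⁻¹ t⁻¹ v` of `vt ∈ X`, `v ∈ G`, `t ∈ M`. -/
def norm (h : G.IsComplement' M) (x : X) : X :=
  (gFactor h x : X)⁻¹ * (mFactor h x : X)⁻¹ * (gFactor h x : X)

/-- The action on the set `X`: `vt ◁̃ us = (s̃ ▷ vu)(s̃ t s̃⁻¹)` with `s̃ = s⁻¹ ◁ (vu)⁻¹`. -/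
def rightAct (h : G.IsComplement' M) (x y : X) : X :=
  let v := gFactor h x
  let t := mFactor h x
  let u := gFactor h y
  let s := mFactor h y
  let s' := ract h s⁻¹ (v * u)⁻¹
  (lact h s' (v * u) : X) * ((s' * t * s'⁻¹ : M) : X)

/-- The `M`-part `⟨w⟩` of a degree `z = ⟨w⟩⁻¹ |w|`, with `⟨w⟩ ∈ M` and `|w| ∈ G`. -/
def mDegree (h : G.IsComplement' M) (z : X) : M := mFactor h z⁻¹

variable (k : Type*) [Field k]

/-- The linear right action `w ↦ w ◁̃ y` of `y ∈ X` on `kX`. -/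
def linAct (h : G.IsComplement' M) (y : X) : (X →₀ k) →ₗ[k] (X →₀ k) :=
  Finsupp.lmapDomain k k fun x => rightAct h x y

/-- The homogeneous component `J_z ⊂ kX` of degree `z`. -/
def component (h : G.IsComplement' M) (z : X) : Submodule k (X →₀ k) :=
  Finsupp.supported k k {x | norm h x = z}

/-- `vt ↦ t ⊗ δ_v`, the identification of `kX` with the dual `H = kM ▷◁ k(G)` of `A`. -/
def toDual (h : G.IsComplement' M) : (X →₀ k) →ₗ[k] Module.Dual k (Bicrossproduct k h) :=
  Finsupp.linearCombination k fun x => Bicrossproduct.coeff (mFactor h x) (gFactor h x)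

/-- `Π : kX → H⁺`, `Π(vt) = t ⊗ δ_v - ε_H(t ⊗ δ_v) 1_H`; here `1_H = ε` and `ε_H(φ) = φ(1)`. -/
def projPlus (h : G.IsComplement' M) [Fintype M] :
    (X →₀ k) →ₗ[k] Module.Dual k (Bicrossproduct k h) :=
  toDual k h - (LinearMap.toSpanSingleton k _ (Coalgebra.counit (R := k))) ∘ₗ
    (LinearMap.applyₗ (1 : Bicrossproduct k h)) ∘ₗ toDual k h

variable {k}

/-- `M₀ ⊂ J_{z₀}` is an irreducible subrepresentation of the centralizer of `z₀` in `X`. -/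
structure IsClassificationDatum (h : G.IsComplement' M) (z₀ : X) (M₀ : Submodule k (X →₀ k)) :
    Prop where
  le : M₀ ≤ component k h z₀
  stable : ∀ y ∈ Subgroup.centralizer {z₀}, M₀.map (linAct k h y) ≤ M₀
  ne_bot : M₀ ≠ ⊥
  irreducible : ∀ N ≤ M₀, (∀ y ∈ Subgroup.centralizer {z₀}, N.map (linAct k h y) ≤ N) →
    N = ⊥ ∨ N = M₀

/-- `∑_{y ∈ X} M₀ ◁̃ y`, the `X`-crossed submodule of `kX` generated by `M₀`. For a classification
datum this is the direct sum of the `M₀ ◁̃ z̄`, one `z̄` for each conjugate `z = z̄⁻¹ z₀ z̄`. -/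
def induced (h : G.IsComplement' M) (M₀ : Submodule k (X →₀ k)) : Submodule k (X →₀ k) :=
  ⨆ y : X, M₀.map (linAct k h y)

/-- `f` is a basis of `W ⊂ kX` and each `f a` is homogeneous of degree `z a`. -/
structure IsHomogeneousBasis (h : G.IsComplement' M) (W : Submodule k (X →₀ k)) {ι : Type*}
    (f : ι → X →₀ k) (z : ι → X) : Prop where
  linearIndependent : LinearIndependent k f
  span_eq : Submodule.span k (Set.range f) = W
  homogeneous : ∀ a, f a ∈ component k h (z a)

end Bicross

end CrossedModule

end

/-! ### Crossed submodules of `kX` and their classification data. -/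

noncomputable section CrossedSubmodules

open scoped Classical

variable {X : Type*} [Group X] {G M : Subgroup X}

namespace Bicross

/-! ### The action and the degree on the set `X` -/

section

variable (h : G.IsComplement' M)

/-! Following Woronowicz, a bicovariant calculus is controlled by its ideal of relations {a ∈ ker ε
: ω(a) = 0}, a right ideal stable under the right adjoint coaction. What makes bicrossproducts
tractable is that both A and its dual can be identified with kX by us ↦ δ_s ⊗ u and us ↦ s ⊗ δ_u,
the pairing becoming the form for which X is orthonormal. The degree satisfies ‖us‖⁻¹ = u⁻¹su =
(u⁻¹(s ▷ u))(s ◁ u), and these two factors govern the adjoint coaction and the product of A. Hence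
Ad-stable right ideals are exactly the graded X-stable subspaces of kX (`toBicross_mul_delta`,
`adjointCoeff_toBicross`). The form is X-invariant and degree projections are self-adjoint, so
orthogonals of crossed submodules are crossed.

Let σ = ∑_{u ∈ G} u. It is X-fixed of degree 1, represents ε in the dual and an integral in A, and
spans ker Π. Since ⟨σ,σ⟩ = |G| ≠ 0 in characteristic 0, Π is injective on σ^⊥. If J ⊂ kX is the
ideal of relations, then L = Π(W) with W = (J + kσ)^⊥. Irreducibility of the calculus makes J
maximal among Ad-stable right ideals properly inside ker ε, so W is a simple crossed module. A
homogeneous component of a simple crossed module is an irreducible representation of the centralizer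
of its degree and generates the whole; this is the datum.

For an arbitrary datum with image L ≠ 0, the induced module is orthogonal to σ
(`IsClassificationDatum.pairing_eq_zero`), so Π carries its bases to bases of L, and these have dual
bases of forms. For the commutator formula, ω(a)x = ∑ x₍₁₎ω(ax₍₂₎) − ε(a)dx is applied to the
integral a = σ, giving ω(σ)x − xω(σ) = −|G|dx. Expanding ω(σ) in the dual basis, orthogonality to σ
leaves only the term from the projection to H⁺, so ω(σ) = −|G|θ. -/

theorem factor_ext {x y : X} (hg : gFactor h x = gFactor h y) (hm : mFactor h x = mFactor h y) :
    x = y := by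
  rw [← factor_mul h x, ← factor_mul h y, hg, hm]

theorem gFactor_coe (u : G) : gFactor h (u : X) = u := by
  simpa using gFactor_mul h u 1

theorem mFactor_coe (u : G) : mFactor h (u : X) = 1 := by
  simpa using mFactor_mul h u 1

theorem mFactor_coe_right (s : M) : mFactor h (s : X) = s := by
  simpa using mFactor_mul h 1 s

theorem gFactor_coe_right (s : M) : gFactor h (s : X) = 1 := by
  simpa using gFactor_mul h 1 s

-- The quotient st⁻¹ = uv⁻¹ lies in G ∩ M = 1. This gives uniqueness of the `s` in `rightAct_spec`.
include h in
theorem eq_of_coe_mul_eq {s t : M} {a : X} {u v : G} (hu : (s : X) * a = u)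
    (hv : (t : X) * a = v) : s = t := by
  have e : ((s * t⁻¹ : M) : X) = ((u * v⁻¹ : G) : X) := by
    push_cast
    rw [← hu, ← hv]
    group
  have h1 : ((s * t⁻¹ : M) : X) = 1 :=
    Subgroup.disjoint_def.mp h.disjoint (e ▸ (u * v⁻¹).2) (s * t⁻¹).2
  exact mul_inv_eq_one.mp (Subtype.ext h1)

theorem rightAct_factor (x y : X) :
    gFactor h (rightAct h x y) =
        lact h (ract h (mFactor h y)⁻¹ (gFactor h x * gFactor h y)⁻¹)
          (gFactor h x * gFactor h y) ∧
      mFactor h (rightAct h x y) =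
        ract h (mFactor h y)⁻¹ (gFactor h x * gFactor h y)⁻¹ * mFactor h x *
          (ract h (mFactor h y)⁻¹ (gFactor h x * gFactor h y)⁻¹)⁻¹ :=
  ⟨gFactor_mul h _ _, mFactor_mul h _ _⟩

/-- `vt ◁̃ y` is `v't'`, where `v' = s'vy` and `t' = s't s'⁻¹` for some `s' ∈ M`. -/
theorem rightAct_spec (x y : X) : ∃ s : M,
    (s : X) * (gFactor h x * y) = gFactor h (rightAct h x y) ∧
      mFactor h (rightAct h x y) = s * mFactor h x * s⁻¹ := by
  refine ⟨_, ?_, (rightAct_factor h x y).2⟩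
  rw [(rightAct_factor h x y).1]
  set u := gFactor h x * gFactor h y with hu
  set s := ract h (mFactor h y)⁻¹ u⁻¹
  have h1 : ract h s u = (mFactor h y)⁻¹ := by
    rw [← (act_mul h _ _ _).2, inv_mul_cancel, (act_one h _).2]
  have h2 := lact_mul_ract h s u
  rw [h1] at h2
  have h3 : (gFactor h x : X) * y = u * mFactor h y := by
    rw [hu, Subgroup.coe_mul, mul_assoc, factor_mul]
  rw [h3, ← mul_assoc, ← h2]
  simp

/-- G is a transversal of M\X: the new G-part represents the coset Mvy, and t is conjugated by the
element of M correcting the representative. Any such element identifies the result, so the action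
laws follow by multiplying witnesses. -/
theorem rightAct_eq {x y z : X} (s : M) (hg : (s : X) * (gFactor h x * y) = gFactor h z)
    (hm : mFactor h z = s * mFactor h x * s⁻¹) : rightAct h x y = z := by
  obtain ⟨t, ht, ht'⟩ := rightAct_spec h x y
  have e := eq_of_coe_mul_eq h hg ht
  subst e
  exact factor_ext h (Subtype.ext (ht.symm.trans hg)) (ht'.trans hm.symm)

theorem rightAct_one (x : X) : rightAct h x 1 = x := rightAct_eq h 1 (by simp) (by simp)

theorem rightAct_mul (x y z : X) : rightAct h x (y * z) = rightAct h (rightAct h x y) z := by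
  obtain ⟨s, hs, hs'⟩ := rightAct_spec h x y
  obtain ⟨t, ht, ht'⟩ := rightAct_spec h (rightAct h x y) z
  apply rightAct_eq h (t * s)
  · rw [← ht, ← hs]
    push_cast
    group
  · rw [ht', hs']
    group

theorem rightAct_injective (y : X) : Function.Injective fun x => rightAct h x y := by
  intro x x' e
  have := congrArg (fun x => rightAct h x y⁻¹) e
  simpa [← rightAct_mul, rightAct_one] using this

theorem norm_rightAct (x y : X) : norm h (rightAct h x y) = y⁻¹ * norm h x * y := by
  obtain ⟨s, hs, hs'⟩ := rightAct_spec h x y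
  unfold norm
  rw [hs', ← hs]
  push_cast
  group

theorem rightAct_mul_coe (u : G) (s : M) (w : G) :
    rightAct h ((u : X) * s) w = ((u * w : G) : X) * s := by
  apply rightAct_eq h 1
  · rw [gFactor_mul, gFactor_mul]
    simp
  · rw [mFactor_mul, mFactor_mul]
    simp

theorem rightAct_mul_coe_right (u : G) (s m : M) :
    rightAct h ((u : X) * s) m =
      (lact h (ract h m⁻¹ u⁻¹) u : X) * ((ract h m⁻¹ u⁻¹ * s * (ract h m⁻¹ u⁻¹)⁻¹ : M) : X) := by
  simp [rightAct, gFactor_mul, mFactor_mul, gFactor_coe_right, mFactor_coe_right]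

/-- The inverse degree is u⁻¹su. Its M-factor is the index tested in products of A, and its G-factor
is the one tested by the adjoint coaction. -/
theorem norm_inv (u : G) (s : M) :
    (norm h ((u : X) * s))⁻¹ = ((u⁻¹ * lact h s u : G) : X) * ract h s u := by
  simp only [norm, gFactor_mul, mFactor_mul]
  rw [Subgroup.coe_mul, mul_assoc ((u⁻¹ : G) : X), lact_mul_ract]
  push_cast
  group

theorem gFactor_norm_inv (u : G) (s : M) :
    gFactor h (norm h ((u : X) * s))⁻¹ = u⁻¹ * lact h s u := by
  rw [norm_inv, gFactor_mul]

theorem mFactor_norm_inv (u : G) (s : M) :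
    mFactor h (norm h ((u : X) * s))⁻¹ = ract h s u := by
  rw [norm_inv, mFactor_mul]

theorem norm_eq_one_iff (x : X) : norm h x = 1 ↔ mFactor h x = 1 := by
  unfold norm
  constructor
  · intro e
    have : ((mFactor h x : X))⁻¹ = 1 := by
      have e' := congrArg (fun a : X => (gFactor h x : X) * a * (gFactor h x : X)⁻¹) e
      simpa [mul_assoc] using e'
    exact Subtype.ext (inv_eq_one.mp this)
  · intro e
    simp [e]

theorem norm_coe_right (s : M) : norm h (s : X) = (s : X)⁻¹ := by
  simp [norm, gFactor_coe_right, mFactor_coe_right]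

end

/-! ### Crossed submodules of `kX` -/

variable {k : Type*} [Field k] (h : G.IsComplement' M)

theorem linAct_single (x y : X) (c : k) :
    linAct k h y (Finsupp.single x c) = Finsupp.single (rightAct h x y) c :=
  Finsupp.mapDomain_single

theorem linAct_one (f : X →₀ k) : linAct k h 1 f = f := by
  have : linAct k h 1 = LinearMap.id := by
    ext x : 2
    simp [linAct_single, rightAct_one]
  simp [this]

theorem linAct_mul (y z : X) (f : X →₀ k) :
    linAct k h (y * z) f = linAct k h z (linAct k h y f) := by
  have : linAct k h (y * z) = linAct k h z ∘ₗ linAct k h y := by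
    ext x : 2
    simp [linAct_single, rightAct_mul]
  simp [this]

theorem linAct_inv_linAct (y : X) (f : X →₀ k) : linAct k h y⁻¹ (linAct k h y f) = f := by
  rw [← linAct_mul, mul_inv_cancel, linAct_one]

theorem linAct_apply_rightAct (y x : X) (f : X →₀ k) :
    linAct k h y f (rightAct h x y) = f x :=
  Finsupp.mapDomain_apply (rightAct_injective h y) f x

variable (k) in
/-- The projection of `kX` onto the sum of the homogeneous components with degree in `p`. -/
def degreeProj (p : X → Prop) : (X →₀ k) →ₗ[k] (X →₀ k) :=
  Finsupp.linearCombination k fun x => if p (norm h x) then Finsupp.single x 1 else 0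

theorem degreeProj_single (p : X → Prop) (x : X) (c : k) :
    degreeProj k h p (Finsupp.single x c) = if p (norm h x) then Finsupp.single x c else 0 := by
  rw [degreeProj, Finsupp.linearCombination_single]
  split_ifs <;> simp

theorem degreeProj_apply (p : X → Prop) (f : X →₀ k) (x : X) :
    degreeProj k h p f x = if p (norm h x) then f x else 0 := by
  have : Finsupp.lapply x ∘ₗ degreeProj k h p =
      (if p (norm h x) then 1 else 0 : k) • Finsupp.lapply x := by
    ext y
    by_cases e : y = x
    · subst e
      by_cases hp : p (norm h y) <;> simp [degreeProj_single, hp]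
    · by_cases hp : p (norm h y) <;> by_cases hp' : p (norm h x) <;>
        simp [degreeProj_single, hp, hp', e]
  have := LinearMap.congr_fun this f
  split_ifs at this ⊢ <;> simpa using this

theorem mem_component {z : X} {f : X →₀ k} :
    f ∈ component k h z ↔ ∀ x, f x ≠ 0 → norm h x = z := by
  rw [component, Finsupp.mem_supported]
  simp [Set.subset_def]

theorem degreeProj_of_pos (p : X → Prop) {z : X} (hp : p z) {f : X →₀ k}
    (hf : f ∈ component k h z) : degreeProj k h p f = f := by
  ext x
  rw [degreeProj_apply]
  by_cases e : f x = 0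
  · simp [e]
  · simp [(mem_component h).mp hf x e, hp]

theorem degreeProj_of_neg (p : X → Prop) {z : X} (hp : ¬ p z) {f : X →₀ k}
    (hf : f ∈ component k h z) : degreeProj k h p f = 0 := by
  ext x
  rw [degreeProj_apply]
  by_cases e : f x = 0
  · simp [e]
  · simp [(mem_component h).mp hf x e, hp]

theorem degreeProj_mem_component (z : X) (f : X →₀ k) :
    degreeProj k h (· = z) f ∈ component k h z := by
  rw [mem_component]
  intro x hx
  by_contra e
  simp [degreeProj_apply, e] at hx

theorem linAct_mem_component {z : X} {f : X →₀ k} (hf : f ∈ component k h z) (y : X) :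
    linAct k h y f ∈ component k h (y⁻¹ * z * y) := by
  rw [mem_component] at hf ⊢
  intro x hx
  have e : x = rightAct h (rightAct h x y⁻¹) y := by
    rw [← rightAct_mul, inv_mul_cancel, rightAct_one]
  rw [e, linAct_apply_rightAct] at hx
  rw [e, norm_rightAct, hf _ hx]

/-- A subspace of `kX` stable under the action of `X` and graded. The grading is expressed through
the two factors of the inverse of the degree. -/
structure IsCrossed (W : Submodule k (X →₀ k)) : Prop where
  linAct_mem : ∀ y, ∀ f ∈ W, linAct k h y f ∈ W
  mProj_mem : ∀ s : M, ∀ f ∈ W, degreeProj k h (fun z => mFactor h z⁻¹ = s) f ∈ W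
  gProj_mem : ∀ u : G, ∀ f ∈ W, degreeProj k h (fun z => gFactor h z⁻¹ = u) f ∈ W

variable {h}

/-- A degree is determined by the two factors of its inverse, so composing the two partial
projections isolates one degree. -/
theorem IsCrossed.degreeProj_mem {W : Submodule k (X →₀ k)} (hW : IsCrossed h W) (z : X)
    {f : X →₀ k} (hf : f ∈ W) : degreeProj k h (· = z) f ∈ W := by
  have := hW.gProj_mem (gFactor h z⁻¹) _ (hW.mProj_mem (mFactor h z⁻¹) f hf)
  convert this using 1
  ext x
  simp only [degreeProj_apply]
  by_cases e : norm h x = z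
  · simp [e]
  · rw [if_neg e]
    split_ifs with h1 h2
    · exact absurd (inv_injective (factor_ext h h1 h2)) e
    all_goals rfl

theorem IsCrossed.sup {V W : Submodule k (X →₀ k)} (hV : IsCrossed h V) (hW : IsCrossed h W) :
    IsCrossed h (V ⊔ W) where
  linAct_mem y := (Submodule.map_le_iff_le_comap.mp ((Submodule.map_sup _ _ _).trans_le
    (sup_le_sup (Submodule.map_le_iff_le_comap.mpr (hV.linAct_mem y))
      (Submodule.map_le_iff_le_comap.mpr (hW.linAct_mem y)))) :)
  mProj_mem s := (Submodule.map_le_iff_le_comap.mp ((Submodule.map_sup _ _ _).trans_le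
    (sup_le_sup (Submodule.map_le_iff_le_comap.mpr (hV.mProj_mem s))
      (Submodule.map_le_iff_le_comap.mpr (hW.mProj_mem s)))) :)
  gProj_mem u := (Submodule.map_le_iff_le_comap.mp ((Submodule.map_sup _ _ _).trans_le
    (sup_le_sup (Submodule.map_le_iff_le_comap.mpr (hV.gProj_mem u))
      (Submodule.map_le_iff_le_comap.mpr (hW.gProj_mem u)))) :)

theorem linAct_mem_induced {M₀ : Submodule k (X →₀ k)} (y : X) {f : X →₀ k} (hf : f ∈ M₀) :
    linAct k h y f ∈ induced h M₀ :=
  (le_iSup (fun y => M₀.map (linAct k h y)) y) (Submodule.mem_map_of_mem hf)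

theorem le_induced (M₀ : Submodule k (X →₀ k)) : M₀ ≤ induced h M₀ := fun f hf => by
  simpa [linAct_one] using linAct_mem_induced (h := h) 1 hf

theorem induced_le {M₀ W : Submodule k (X →₀ k)} :
    induced h M₀ ≤ W ↔ ∀ y, ∀ f ∈ M₀, linAct k h y f ∈ W :=
  iSup_le_iff.trans (forall_congr' fun _ => Submodule.map_le_iff_le_comap)

/-- Translates of homogeneous vectors are homogeneous, so a degree projection either fixes or kills
each generator. -/
theorem isCrossed_induced {z : X} {M₀ : Submodule k (X →₀ k)} (hM : M₀ ≤ component k h z) :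
    IsCrossed h (induced h M₀) := by
  have key (p : X → Prop) : ∀ f ∈ induced h M₀, degreeProj k h p f ∈ induced h M₀ := by
    refine (induced_le (W := (induced h M₀).comap (degreeProj k h p))).mpr fun y f hf => ?_
    rw [Submodule.mem_comap]
    by_cases hp : p (y⁻¹ * z * y)
    · rw [degreeProj_of_pos h p hp (linAct_mem_component h (hM hf) y)]
      exact linAct_mem_induced y hf
    · rw [degreeProj_of_neg h p hp (linAct_mem_component h (hM hf) y)]
      exact zero_mem _
  refine ⟨fun y => ?_, fun s => key _, fun u => key _⟩
  refine (induced_le (W := (induced h M₀).comap (linAct k h y))).mpr fun y' f hf => ?_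
  rw [Submodule.mem_comap, ← linAct_mul]
  exact linAct_mem_induced _ hf

/-- A nonzero simple crossed submodule of `kX` is induced by a classification datum. -/
theorem IsCrossed.exists_isClassificationDatum {W : Submodule k (X →₀ k)} (hW : IsCrossed h W)
    (hne : W ≠ ⊥) (hs : ∀ V ≤ W, IsCrossed h V → V = ⊥ ∨ V = W) :
    ∃ z₀ M₀, IsClassificationDatum h z₀ M₀ ∧ induced h M₀ = W := by
  obtain ⟨f, hf, hf0⟩ := (Submodule.ne_bot_iff W).mp hne
  obtain ⟨x, hx⟩ := Finsupp.ne_iff.mp hf0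
  -- By simplicity, every nonzero subspace of this homogeneous component already generates `W`.
  have hN : ∀ N ≤ W ⊓ component k h (norm h x), N ≠ ⊥ → induced h N = W := by
    intro N hN hN0
    refine (hs _ (induced_le.mpr fun y f hf => hW.linAct_mem y f (hN hf).1)
      (isCrossed_induced (hN.trans inf_le_right))).resolve_left fun e => hN0 ?_
    exact eq_bot_iff.mpr (e ▸ le_induced N)
  have h0 : W ⊓ component k h (norm h x) ≠ ⊥ := by
    refine (Submodule.ne_bot_iff _).mpr ⟨_, ⟨hW.degreeProj_mem (norm h x) hf,
      degreeProj_mem_component h _ f⟩, Finsupp.ne_iff.mpr ⟨x, ?_⟩⟩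
    simpa [degreeProj_apply] using hx
  refine ⟨norm h x, W ⊓ component k h (norm h x), ⟨inf_le_right, ?_, h0, ?_⟩, hN _ le_rfl h0⟩
  · rintro y hy _ ⟨f, hf, rfl⟩
    refine ⟨hW.linAct_mem y f hf.1, ?_⟩
    have := linAct_mem_component h hf.2 y
    rwa [mul_assoc, ← Subgroup.mem_centralizer_singleton_iff.mp hy, inv_mul_cancel_left] at this
  · intro N hNle hNs
    by_cases hN0 : N = ⊥
    · exact Or.inl hN0
    refine Or.inr (le_antisymm hNle fun f hf => ?_)
    -- Back in the original degree only the translates by centralizing elements survive, and these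
    -- stay in `N`. As `N` generates `W`, the whole component of `W` lies in `N`.
    have hi : induced h N ≤ N.comap (degreeProj k h (· = norm h x)) := by
      refine induced_le.mpr fun y g hg => ?_
      rw [Submodule.mem_comap]
      have hc := linAct_mem_component h (hNle hg).2 y
      by_cases hy : y⁻¹ * norm h x * y = norm h x
      · rw [degreeProj_of_pos h (· = norm h x) hy hc]
        refine hNs y ?_ (Submodule.mem_map_of_mem hg)
        rw [Subgroup.mem_centralizer_singleton_iff]
        nth_rewrite 1 [← hy]
        group
      · rw [degreeProj_of_neg h (· = norm h x) hy hc]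
        exact zero_mem _
    have := hi ((hN N hNle hN0).symm ▸ hf.1)
    rwa [Submodule.mem_comap, degreeProj_of_pos h (· = norm h x) rfl hf.2] at this

/-- Translates of a basis of `M₀` along coset representatives form a homogeneous basis of the
induced crossed module. -/
theorem IsClassificationDatum.isHomogeneousBasis {z₀ : X} {M₀ : Submodule k (X →₀ k)}
    (hM : IsClassificationDatum h z₀ M₀) {ι : Type*} {f₀ : ι → X →₀ k}
    (hli : LinearIndependent k f₀) (hsp : Submodule.span k (Set.range f₀) = M₀)
    (zbar : {z : X // IsConj z₀ z} → X) (hz : ∀ z, (zbar z)⁻¹ * z₀ * zbar z = z) :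
    IsHomogeneousBasis h (induced h M₀)
      (fun p : ι × {z : X // IsConj z₀ z} => linAct k h (zbar p.2) (f₀ p.1)) (fun p => p.2) := by
  have hf₀ : ∀ i, f₀ i ∈ M₀ := fun i => hsp ▸ Submodule.subset_span (Set.mem_range_self i)
  have hhom : ∀ (i : ι) (z : {z : X // IsConj z₀ z}),
      linAct k h (zbar z) (f₀ i) ∈ component k h z := fun i z => by
    have := linAct_mem_component h (hM.le (hf₀ i)) (zbar z)
    rwa [hz] at this
  refine ⟨?_, ?_, fun p => hhom p.1 p.2⟩
  · rw [linearIndependent_iff']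
    intro s g hg p hp
    -- Projecting the relation to the degree of `p` and translating back by `zbar p.2` leaves a
    -- relation among the `f₀`.
    have h1 : ∑ q ∈ s with q.2 = p.2, g q • f₀ q.1 = 0 := by
      have := congrArg (linAct k h (zbar p.2)⁻¹ ∘ degreeProj k h (· = (p.2 : X))) hg
      simp only [Function.comp_apply, map_sum, map_smul, map_zero] at this
      rw [← this, Finset.sum_filter]
      refine Finset.sum_congr rfl fun q _ => ?_
      split_ifs with e
      · rw [e, degreeProj_of_pos h (· = (p.2 : X)) rfl (hhom q.1 p.2), linAct_inv_linAct]
      · rw [degreeProj_of_neg h (· = (p.2 : X)) (fun e' => e (Subtype.ext e')) (hhom q.1 q.2), map_zero,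
          smul_zero]
    have hli' : LinearIndepOn k (fun q : ι × {z : X // IsConj z₀ z} => f₀ q.1)
        (s.filter (fun q => q.2 = p.2) : Finset _) := by
      refine hli.comp (fun q : (s.filter (fun q => q.2 = p.2) : Finset _) => q.1.1) ?_
      rintro ⟨q, hq⟩ ⟨q', hq'⟩ e
      simp only [Finset.mem_filter] at hq hq'
      exact Subtype.ext (Prod.ext e (hq.2.trans hq'.2.symm))
    exact linearIndepOn_finset_iff.mp hli' g h1 p (Finset.mem_filter.mpr ⟨hp, rfl⟩)
  · refine le_antisymm (Submodule.span_le.mpr ?_) (induced_le.mpr fun y f hf => ?_)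
    · rintro _ ⟨p, rfl⟩
      exact linAct_mem_induced _ (hf₀ _)
    · have hc : IsConj z₀ (y⁻¹ * z₀ * y) := isConj_iff.mpr ⟨y⁻¹, by simp⟩
      have hy : _ = y⁻¹ * z₀ * y := hz ⟨_, hc⟩
      set b := zbar ⟨_, hc⟩ with hb
      -- Both y and b conjugate z₀ to the same element, so yb⁻¹ centralizes z₀.
      have hyb : linAct k h (y * b⁻¹) f ∈ M₀ := by
        refine hM.stable _ ?_ (Submodule.mem_map_of_mem hf)
        rw [Subgroup.mem_centralizer_singleton_iff]
        have : z₀ = b * (y⁻¹ * z₀ * y) * b⁻¹ := by rw [← hy]; group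
        nth_rewrite 1 [this]
        group
      have e : linAct k h y f = linAct k h b (linAct k h (y * b⁻¹) f) := by
        rw [← linAct_mul, inv_mul_cancel_right]
      rw [e]
      rw [← hsp] at hyb
      refine Submodule.span_induction (p := fun f _ => linAct k h b f ∈ _) ?_ ?_ ?_ ?_ hyb
      · rintro _ ⟨i, rfl⟩
        exact Submodule.subset_span ⟨(i, ⟨_, hc⟩), rfl⟩
      · simp
      · intro f g _ _ hf hg
        rw [map_add]
        exact add_mem hf hg
      · intro c f _ hf
        rw [map_smul]
        exact Submodule.smul_mem _ _ hf

end Bicross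

end CrossedSubmodules

/-! ### The Maurer–Cartan form, its coactions and its commutation rule. -/

noncomputable section Calculi

open scoped Classical

namespace Bicross

variable {X : Type*} [Group X] {G M : Subgroup X} (h : G.IsComplement' M)

theorem ract_mul_inv (b c : M) (u : G) :
    ract h (b * c⁻¹) (lact h c u) = ract h b u * (ract h c u)⁻¹ := by
  rw [eq_mul_inv_iff_mul_eq, ← (mul_act h _ _ _).2, inv_mul_cancel_right]

theorem lact_mul_inv (b c : M) (u : G) : lact h (b * c⁻¹) (lact h c u) = lact h b u := by
  rw [← (mul_act h _ _ _).1, inv_mul_cancel_right]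

theorem ract_ract_inv (s : M) (u : G) : ract h (ract h s u) u⁻¹ = s := by
  rw [← (act_mul h _ _ _).2, mul_inv_cancel, (act_one h _).2]

theorem ract_inv_ract (s : M) (u : G) : ract h (ract h s u⁻¹) u = s := by
  rw [← (act_mul h _ _ _).2, inv_mul_cancel, (act_one h _).2]

theorem lact_ract_inv (s : M) (u : G) : lact h (ract h s u) u⁻¹ = (lact h s u)⁻¹ := by
  have := (act_mul h s u u⁻¹).1
  rw [mul_inv_cancel, (act_one h _).1] at this
  exact (inv_eq_of_mul_eq_one_right this.symm).symm

end Bicross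

theorem Bicrossproduct.sum_delta_one_smul {k : Type*} [Field k] {X : Type*} [Group X]
    {G M : Subgroup X} [Fintype M] (h : G.IsComplement' M) {Ω : Type*} [AddCommGroup Ω]
    [Module (Bicrossproduct k h) Ω] (η : Ω) :
    ∑ b : M, (delta b 1 : Bicrossproduct k h) • η = η := by
  rw [← Finset.sum_smul, ← one_def, one_smul]

theorem leftMulForm_apply {k A Ω : Type*} [Field k] [Ring A] [Algebra k A] [AddCommGroup Ω]
    [Module k Ω] [Module A Ω] [IsScalarTower k A Ω] (a : A) (η : Ω) :
    leftMulForm k A Ω a η = a • η := rfl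

theorem rightMulForm_apply {k A Ω : Type*} [Field k] [Ring A] [Algebra k A] [AddCommGroup Ω]
    [Module k Ω] [Module Aᵐᵒᵖ Ω] [IsScalarTower k Aᵐᵒᵖ Ω] (a : A) (η : Ω) :
    rightMulForm k A Ω a η = MulOpposite.op a • η := rfl

namespace BicovariantCalculus

section Hopf

variable {k A Ω : Type*} [Field k] [Ring A] [HopfAlgebra k A]
  [AddCommGroup Ω] [Module k Ω] [Module A Ω] [Module Aᵐᵒᵖ Ω] [SMulCommClass A Aᵐᵒᵖ Ω]
  [IsScalarTower k A Ω] [IsScalarTower k Aᵐᵒᵖ Ω] (Γ : BicovariantCalculus k A Ω)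

theorem d_one : Γ.d 1 = 0 := by
  have := Γ.leibniz 1 1
  simpa using this

theorem maurerCartan_one : Γ.maurerCartan 1 = 0 := by
  simp [maurerCartan, Algebra.TensorProduct.one_def, d_one]

/-- Since ω(1) = 0, subtracting ε(a)1 removes the condition ε(a) = 0. -/
theorem tangentSpace_eq : Γ.tangentSpace = (LinearMap.ker Γ.maurerCartan).dualAnnihilator := by
  ext φ
  rw [Submodule.mem_dualAnnihilator]
  constructor
  · rintro ⟨h1, h2⟩ a ha
    have := h2 (a - algebraMap k A (Coalgebra.counit a)) (by simp)
      (by rw [map_sub, LinearMap.mem_ker.mp ha, Algebra.algebraMap_eq_smul_one, map_smul,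
        maurerCartan_one]; simp)
    rw [map_sub, Algebra.algebraMap_eq_smul_one, map_smul, h1, smul_zero, sub_zero] at this
    exact this
  · intro hφ
    exact ⟨hφ 1 Γ.maurerCartan_one, fun a _ ha => hφ a ha⟩

/-- The projection `η ↦ S(η₍₋₁₎) η₍₀₎` onto the left-invariant forms. -/
def invariantProj : Ω →ₗ[k] Ω :=
  TensorProduct.lift (leftMulForm k A Ω) ∘ₗ (HopfAlgebra.antipode k).rTensor Ω ∘ₗ Γ.coactL

theorem invariantProj_of_mem {η : Ω} (hη : η ∈ Γ.leftInvariant) : Γ.invariantProj η = η := by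
  have : Γ.coactL η = 1 ⊗ₜ η := sub_eq_zero.mp hη
  simp [invariantProj, this, leftMulForm]

/-- For invariant η the projection of aη is S(a₍₁₎)a₍₂₎η, which the antipode axiom collapses. -/
theorem invariantProj_smul (a : A) {η : Ω} (hη : η ∈ Γ.leftInvariant) :
    Γ.invariantProj (a • η) = (Coalgebra.counit a : k) • η := by
  have h1 : Γ.coactL η = 1 ⊗ₜ η := sub_eq_zero.mp hη
  have h2 := HopfAlgebra.mul_antipode_rTensor_comul_apply (R := k) a
  have h3 : ∀ t : A ⊗[k] A, TensorProduct.lift (leftMulForm k A Ω)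
      ((HopfAlgebra.antipode k).rTensor Ω
        (TensorProduct.map₂ (LinearMap.mul k A) (leftMulForm k A Ω) t (1 ⊗ₜ η))) =
      LinearMap.mul' k A ((HopfAlgebra.antipode k).rTensor A t) • η := by
    intro t
    induction t with
    | zero => simp
    | add s t hs ht => simp only [map_add, LinearMap.add_apply, hs, ht, add_smul]
    | tmul a b => simp [leftMulForm, mul_smul]
  simp only [invariantProj, LinearMap.comp_apply, Γ.coactL_left, h1, h3]
  rw [h2, algebraMap_smul]

end Hopf

open Bicross Bicrossproduct

variable {k : Type*} [Field k] {X : Type*} [Group X] {G M : Subgroup X} [Fintype M]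
  {h : G.IsComplement' M} {Ω : Type*} [AddCommGroup Ω] [Module k Ω]
  [Module (Bicrossproduct k h) Ω] [Module (Bicrossproduct k h)ᵐᵒᵖ Ω]
  [SMulCommClass (Bicrossproduct k h) (Bicrossproduct k h)ᵐᵒᵖ Ω]
  [IsScalarTower k (Bicrossproduct k h) Ω] [IsScalarTower k (Bicrossproduct k h)ᵐᵒᵖ Ω]
  (Γ : BicovariantCalculus k (Bicrossproduct k h) Ω)

theorem maurerCartan_delta (s : M) (u : G) :
    Γ.maurerCartan (delta s u) =
      ∑ b : M, (delta (ract h b u * (ract h s u)⁻¹) (lact h s u)⁻¹ : Bicrossproduct k h) •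
        Γ.d (delta b u) := by
  simp only [maurerCartan, LinearMap.comp_apply, comul_delta, map_sum, TensorProduct.map_tmul,
    TensorProduct.lift.tmul, antipode_delta, ract_mul_inv, lact_mul_inv, mul_inv_rev, inv_inv]
  rfl

theorem d_delta (s : M) (u : G) :
    Γ.d (delta s u) =
      ∑ b : M, (delta (s * b⁻¹) (lact h b u) : Bicrossproduct k h) •
        Γ.maurerCartan (delta b u) := by
  simp only [maurerCartan_delta, Finset.smul_sum, smul_smul, delta_mul_delta, ract_mul_inv,
    mul_left_inj, ite_smul, zero_smul, mul_inv_cancel]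
  have : ∀ c, ract h s u = ract h c u ↔ s = c := fun c => ⟨fun e => ract_inj h e, fun e => e ▸ rfl⟩
  simp only [this, Finset.sum_ite_eq, Finset.mem_univ, if_true]
  rw [← Finset.sum_smul]
  conv_lhs => rw [← sum_delta_one_smul (k := k) h (Γ.d (delta s u)), ← Finset.sum_smul]
  congr 1
  exact Fintype.sum_equiv ((Equiv.inv M).trans (Equiv.mulLeft s)).symm _ _ fun b => by simp

theorem maurerCartan_mem (a : Bicrossproduct k h) : Γ.maurerCartan a ∈ Γ.leftInvariant := by
  induction a using ind with
  | ha a b ha hb => rw [map_add]; exact add_mem ha hb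
  | hs c a ha => rw [map_smul]; exact Submodule.smul_mem _ _ ha
  | hd s u =>
  change Γ.coactL _ - 1 ⊗ₜ[k] _ = 0
  rw [sub_eq_zero, maurerCartan_delta, map_sum]
  simp only [coactL_left, coactL_d, comul_delta, map_sum, LinearMap.sum_apply,
    TensorProduct.map₂_apply_tmul, TensorProduct.map_tmul, LinearMap.lTensor_tmul,
    LinearMap.mul_apply', leftMulForm_apply]
  -- In the A-leg a single `g` survives, with trivial G-part; summing over `b` then assembles the
  -- unit of A.
  have key : ∀ b c g : M,
      (delta (ract h b u * (ract h s u)⁻¹ * g⁻¹) (lact h g (lact h s u)⁻¹) *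
        delta (b * c⁻¹) (lact h c u) : Bicrossproduct k h) =
      if g = ract h c u * (ract h s u)⁻¹ then delta (ract h b u * (ract h c u)⁻¹) 1 else 0 := by
    intro b c g
    have e0 : ∀ c : M, ract h (ract h c u * (ract h s u)⁻¹) (lact h s u)⁻¹ = c * s⁻¹ := by
      intro c
      rw [← ract_mul_inv, ract_ract_inv]
    have e1 : ract h (ract h b u * (ract h s u)⁻¹ * g⁻¹) (lact h g (lact h s u)⁻¹) = b * c⁻¹ ↔
        g = ract h c u * (ract h s u)⁻¹ := by
      rw [ract_mul_inv, e0]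
      constructor
      · intro e
        refine ract_inj h (u := (lact h s u)⁻¹) ?_
        rw [e0]
        have e' : ract h g (lact h s u)⁻¹ = (b * c⁻¹)⁻¹ * (b * s⁻¹) := by rw [← e]; group
        rw [e']
        group
      · rintro rfl
        rw [e0]
        group
    rw [delta_mul_delta]
    simp only [e1]
    split_ifs with e
    · subst e
      congr 1
      · group
      · rw [← ract_mul_inv, lact_ract_inv, lact_mul_inv, inv_mul_cancel]
    · rfl
  simp only [key, TensorProduct.ite_tmul, Finset.sum_ite_eq', Finset.mem_univ,
    if_true]
  rw [Finset.sum_comm, TensorProduct.tmul_sum]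
  refine Finset.sum_congr rfl fun c _ => ?_
  rw [← TensorProduct.sum_tmul, one_def]
  congr 1
  exact Fintype.sum_bijective (fun b => ract h b u * (ract h c u)⁻¹)
    (Finite.injective_iff_bijective.mp fun _ _ e => ract_inj h (mul_right_cancel e)) _ _ fun _ => rfl

/-- The component at `δ_r ⊗ w` of the right adjoint coaction `a ↦ a₍₂₎ ⊗ S(a₍₁₎) a₍₃₎`. -/
def _root_.Bicrossproduct.adjointCoeff (r : M) (w : G) :
    Bicrossproduct k h →ₗ[k] Bicrossproduct k h :=
  lift fun s u => if (lact h s u)⁻¹ * u = w then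
    delta (ract h r (lact h s u)⁻¹ * s * (ract h r (lact h s u)⁻¹)⁻¹)
      (lact h (ract h r (lact h s u)⁻¹) u) else 0

/-- This is Δ_R ω(a) = ω(a₍₂₎) ⊗ S(a₍₁₎)a₍₃₎: the form ω intertwines the adjoint coaction with the
right coaction on forms. -/
theorem coactR_maurerCartan [Fintype G] (a : Bicrossproduct k h) :
    Γ.coactR (Γ.maurerCartan a) =
      ∑ r : M, ∑ w : G, Γ.maurerCartan (adjointCoeff r w a) ⊗ₜ[k] delta r w := by
  induction a using ind with
  | ha a b ha hb =>
    simp only [map_add, ha, hb, TensorProduct.add_tmul, Finset.sum_add_distrib]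
  | hs c a ha =>
    simp only [map_smul, ha, TensorProduct.smul_tmul', Finset.smul_sum]
  | hd s u =>
  simp only [adjointCoeff, lift_delta, apply_ite Γ.maurerCartan, map_zero, TensorProduct.ite_tmul,
    Finset.sum_ite_eq, Finset.mem_univ, if_true]
  rw [maurerCartan_delta, map_sum]
  simp only [coactR_left, coactR_d, comul_delta, map_sum, LinearMap.sum_apply,
    TensorProduct.map₂_apply_tmul, TensorProduct.map_tmul, LinearMap.rTensor_tmul,
    LinearMap.mul_apply', leftMulForm_apply, delta_mul_delta, TensorProduct.tmul_ite]
  have e : ∀ b : M, (∑ c : M, ∑ g : M,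
      if ract h g (lact h s u)⁻¹ = c then
        ((delta (ract h b u * (ract h s u)⁻¹ * g⁻¹) (lact h g (lact h s u)⁻¹) :
            Bicrossproduct k h) • Γ.d (delta (b * c⁻¹) (lact h c u))) ⊗ₜ[k]
          (delta g ((lact h s u)⁻¹ * u) : Bicrossproduct k h) else 0) =
      ∑ g : M, ((delta (ract h b u * (ract h s u)⁻¹ * g⁻¹) (lact h g (lact h s u)⁻¹) :
            Bicrossproduct k h) • Γ.d (delta (b * (ract h g (lact h s u)⁻¹)⁻¹)
              (lact h (ract h g (lact h s u)⁻¹) u))) ⊗ₜ[k]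
          (delta g ((lact h s u)⁻¹ * u) : Bicrossproduct k h) := fun b => by
    rw [Finset.sum_comm]
    simp only [Finset.sum_ite_eq, Finset.mem_univ, if_true]
  simp only [e]
  rw [Finset.sum_comm]
  refine Finset.sum_congr rfl fun g _ => ?_
  rw [← TensorProduct.sum_tmul, maurerCartan_delta]
  congr 1
  -- With this `c`, the forms attached to `g` sum to ω of a basis element whose M-part is csc⁻¹.
  set c := ract h g (lact h s u)⁻¹ with hc
  have hg : g = ract h c (lact h s u) := (ract_inv_ract h g _).symm
  have h1 : lact h (c * s * c⁻¹) (lact h c u) = lact h c (lact h s u) := by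
    rw [lact_mul_inv, (mul_act h _ _ _).1]
  have h2 : ract h (c * s * c⁻¹) (lact h c u) = g * ract h s u * (ract h c u)⁻¹ := by
    rw [ract_mul_inv, (mul_act h _ _ _).2, ← hg]
  refine Fintype.sum_equiv (Equiv.mulRight c⁻¹) _ _ fun b => ?_
  rw [Equiv.coe_mulRight, h1, h2, ract_mul_inv, hg, lact_ract_inv]
  congr 2
  group

/-- By Leibniz, ω(a)x = S(a₍₁₎)d(a₍₂₎x) − ε(a)dx, and the first term equals x₍₁₎ω(ax₍₂₎). -/
theorem op_smul_maurerCartan_delta (s t : M) (u w : G) :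
    MulOpposite.op (delta t w : Bicrossproduct k h) • Γ.maurerCartan (delta s u) =
      (delta (t * (ract h s u)⁻¹) (lact h (ract h s u) w) : Bicrossproduct k h) •
        Γ.maurerCartan (delta s (u * w)) - (if s = 1 then 1 else 0 : k) • Γ.d (delta t w) := by
  have e : ∀ (a : Bicrossproduct k h) (b : M),
      MulOpposite.op (delta t w : Bicrossproduct k h) • a • Γ.d (delta b u) =
        a • Γ.d (delta b u * delta t w) -
          (a * delta b u : Bicrossproduct k h) • Γ.d (delta t w) := fun a b => by
    rw [Γ.leibniz, mul_smul, ← smul_comm, smul_add, add_sub_cancel_left]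
  simp only [maurerCartan_delta, Finset.smul_sum, e, Finset.sum_sub_distrib]
  congr 1
  · rw [Finset.sum_eq_single (ract h t u⁻¹), Finset.sum_eq_single (ract h t u⁻¹)]
    · rw [delta_mul_delta, ract_inv_ract, if_pos rfl, smul_smul, delta_mul_delta,
        (act_mul h _ _ _).2, (act_mul h _ _ _).2, ract_inv_ract, ract_mul_inv, if_pos rfl,
        (act_mul h _ _ _).1]
      congr 2
      group
    · intro b _ hb
      rw [smul_smul, delta_mul_delta, if_neg, zero_smul]
      intro e
      apply hb
      rw [ract_mul_inv, (act_mul h _ _ _).2, (act_mul h _ _ _).2, mul_left_inj] at e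
      rw [ract_inj h e, ract_ract_inv]
    · simp
    · intro b _ hb
      rw [delta_mul_delta, if_neg, map_zero, smul_zero]
      rintro rfl
      exact hb (ract_ract_inv h _ _).symm
    · simp
  · have e' : ∀ b : M, (delta (ract h b u * (ract h s u)⁻¹) (lact h s u)⁻¹ * delta b u :
        Bicrossproduct k h) = if s = 1 then delta (ract h b u) 1 else 0 := fun b => by
      rw [delta_mul_delta, ← ract_mul_inv, ract_ract_inv]
      by_cases hs : s = 1
      · subst hs
        simp [(one_act h _).1]
      · simp [hs]
    simp only [e']
    split_ifs with hs
    · rw [one_smul]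
      conv_rhs => rw [← sum_delta_one_smul (k := k) h (Γ.d (delta t w))]
      exact Fintype.sum_bijective (fun b => ract h b u)
        (Finite.injective_iff_bijective.mp fun _ _ e => ract_inj h e) _ _ fun _ => rfl
    · simp

/-- This commutation rule yields both the right-ideal property of the relations and, for an integral
`a`, the inner form of d. -/
theorem op_smul_maurerCartan (a : Bicrossproduct k h) (t : M) (w : G) :
    MulOpposite.op (delta t w : Bicrossproduct k h) • Γ.maurerCartan a =
      ∑ c : M, (delta (t * c⁻¹) (lact h c w) : Bicrossproduct k h) •
        Γ.maurerCartan (a * delta c w) - (Coalgebra.counit a : k) • Γ.d (delta t w) := by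
  induction a using ind with
  | ha a b ha hb =>
    simp only [map_add, smul_add, ha, hb, add_mul, Finset.sum_add_distrib, add_smul]
    abel
  | hs c a ha =>
    rw [map_smul, smul_comm, ha]
    simp only [map_smul, smul_mul_assoc, smul_comm _ c, ← Finset.smul_sum, smul_sub, smul_assoc]
  | hd s u =>
    rw [op_smul_maurerCartan_delta, counit_delta]
    simp only [delta_mul_delta, apply_ite Γ.maurerCartan, map_zero, smul_ite, smul_zero,
      Finset.sum_ite_eq, Finset.mem_univ, if_true]

end BicovariantCalculus

end Calculi

/-! ### Ad-stable right ideals, sub-bicomodule bimodules and dual bases. -/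

noncomputable section AdIdeals

open scoped Classical

open Bicross Bicrossproduct

variable {k : Type*} [Field k] {X : Type*} [Group X] {G M : Subgroup X} [Fintype M]
  {h : G.IsComplement' M}

/-- A right ideal of the bicrossproduct stable under the right adjoint coaction. -/
structure Bicrossproduct.IsAdIdeal (I : Submodule k (Bicrossproduct k h)) : Prop where
  mul_mem : ∀ a ∈ I, ∀ (t : M) (w : G), a * delta t w ∈ I
  adjointCoeff_mem : ∀ a ∈ I, ∀ (r : M) (w : G), adjointCoeff r w a ∈ I

theorem Bicrossproduct.counit_adjointCoeff (r : M) (w : G) (a : Bicrossproduct k h) :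
    Coalgebra.counit (R := k) (adjointCoeff r w a) = if w = 1 then Coalgebra.counit a else 0 := by
  induction a using ind with
  | ha a b ha hb => simp only [map_add, ha, hb]; split_ifs <;> simp
  | hs c a ha => simp only [map_smul, ha]; split_ifs <;> simp
  | hd s u =>
    rw [adjointCoeff, lift_delta, counit_delta]
    by_cases hs : s = 1
    · subst hs
      by_cases hw : w = 1
      · simp [hw, (one_act h _).1, counit_delta]
      · simp [hw, (one_act h _).1, Ne.symm hw]
    · split_ifs <;> simp [counit_delta, hs]

namespace BicovariantCalculus

variable {Ω : Type*} [AddCommGroup Ω] [Module k Ω]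
  [Module (Bicrossproduct k h) Ω] [Module (Bicrossproduct k h)ᵐᵒᵖ Ω]
  [SMulCommClass (Bicrossproduct k h) (Bicrossproduct k h)ᵐᵒᵖ Ω]
  [IsScalarTower k (Bicrossproduct k h) Ω] [IsScalarTower k (Bicrossproduct k h)ᵐᵒᵖ Ω]
  (Γ : BicovariantCalculus k (Bicrossproduct k h) Ω)

/-- The ideal `{a ∈ ker ε : ω(a) = 0}` of a calculus. -/
def relations : Submodule k (Bicrossproduct k h) :=
  LinearMap.ker (Coalgebra.counit (R := k) (A := Bicrossproduct k h)) ⊓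
    LinearMap.ker Γ.maurerCartan

/-- If ε(a) and ω(a) vanish, projecting the commutation rule to invariant forms isolates ω(ax) = 0,
and reading coefficients of the right coaction gives Ad-stability. -/
theorem isAdIdeal_relations [Fintype G] : IsAdIdeal Γ.relations where
  mul_mem := by
    rintro a ⟨h1, h2⟩ t w
    rw [SetLike.mem_coe, LinearMap.mem_ker] at h1 h2
    refine ⟨by simp [h1], ?_⟩
    have := congrArg Γ.invariantProj (Γ.op_smul_maurerCartan a t w)
    rw [h1, h2, smul_zero, map_zero, zero_smul, sub_zero, map_sum] at this
    simp only [Γ.invariantProj_smul _ (Γ.maurerCartan_mem _), counit_delta, mul_inv_eq_one,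
      ite_smul, one_smul, zero_smul, Finset.sum_ite_eq, Finset.mem_univ, if_true] at this
    exact this.symm
  adjointCoeff_mem := by
    rintro a ⟨h1, h2⟩ r w
    rw [SetLike.mem_coe, LinearMap.mem_ker] at h1 h2
    refine ⟨by simp [counit_adjointCoeff, h1], ?_⟩
    have := congrArg ((coeff r w).lTensor Ω) (Γ.coactR_maurerCartan a)
    rw [h2, map_zero, map_zero, map_sum] at this
    simp only [map_sum, LinearMap.lTensor_tmul, coeff_delta, ite_and, TensorProduct.tmul_ite,
      Finset.sum_ite_eq', Finset.mem_univ, if_true, Finset.sum_ite_irrel,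
      Finset.sum_const_zero] at this
    have := congrArg (TensorProduct.rid k Ω) this
    simpa using this.symm

theorem span_smul_maurerCartan : Submodule.span k
    {η : Ω | ∃ a b : Bicrossproduct k h, η = a • Γ.maurerCartan b} = ⊤ := by
  rw [← top_le_iff, ← Γ.surjective, Submodule.span_le]
  rintro _ ⟨a, b, rfl⟩
  induction b using ind with
  | ha b c hb hc => rw [map_add, smul_add]; exact add_mem hb hc
  | hs r b hb => rw [map_smul, smul_comm]; exact Submodule.smul_mem _ _ hb
  | hd s u =>
    rw [d_delta, Finset.smul_sum]
    refine sum_mem fun b _ => Submodule.subset_span ⟨_, _, smul_smul _ _ _⟩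

theorem range_maurerCartan : LinearMap.range Γ.maurerCartan = Γ.leftInvariant := by
  refine le_antisymm ?_ fun η hη => ?_
  · rintro _ ⟨a, rfl⟩
    exact Γ.maurerCartan_mem a
  · rw [← Γ.invariantProj_of_mem hη]
    have hs : η ∈ Submodule.span k
      {η : Ω | ∃ a b : Bicrossproduct k h, η = a • Γ.maurerCartan b} :=
      Γ.span_smul_maurerCartan ▸ Submodule.mem_top
    refine (Submodule.span_le (p := (LinearMap.range Γ.maurerCartan).comap Γ.invariantProj)).mpr
      ?_ hs
    rintro _ ⟨a, b, rfl⟩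
    rw [SetLike.mem_coe, Submodule.mem_comap, Γ.invariantProj_smul a (Γ.maurerCartan_mem b)]
    exact Submodule.smul_mem _ _ ⟨b, rfl⟩

/-- A zero tangent space forces ω = 0 by double annihilation, but the forms aω(b) span Ω. -/
theorem tangentSpace_ne_bot [Nontrivial Ω] : Γ.tangentSpace ≠ ⊥ := by
  intro e
  rw [tangentSpace_eq] at e
  have e' := congrArg Submodule.dualCoannihilator e
  rw [Subspace.dualAnnihilator_dualCoannihilator_eq, Submodule.dualCoannihilator_bot] at e'
  have : (⊤ : Submodule k Ω) = ⊥ := by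
    rw [← Γ.span_smul_maurerCartan, Submodule.span_eq_bot]
    rintro _ ⟨a, b, rfl⟩
    rw [LinearMap.mem_ker.mp (e' ▸ Submodule.mem_top : b ∈ LinearMap.ker Γ.maurerCartan),
      smul_zero]
  exact bot_ne_top this.symm

/-- The sub-bimodule generated by the forms `ω(b)` with `b ∈ I`. -/
def formsOf (I : Submodule k (Bicrossproduct k h)) : Submodule k Ω :=
  Submodule.span k {η : Ω | ∃ a : Bicrossproduct k h, ∃ b ∈ I, η = a • Γ.maurerCartan b}

variable {Γ} {I : Submodule k (Bicrossproduct k h)}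

theorem smul_mem_formsOf (a : Bicrossproduct k h) {b : Bicrossproduct k h} (hb : b ∈ I) :
    a • Γ.maurerCartan b ∈ Γ.formsOf I := Submodule.subset_span ⟨a, b, hb, rfl⟩

theorem formsOf_le {N : Submodule k Ω}
    (hN : ∀ a : Bicrossproduct k h, ∀ b ∈ I, a • Γ.maurerCartan b ∈ N) : Γ.formsOf I ≤ N := by
  refine Submodule.span_le.mpr ?_
  rintro _ ⟨a, b, hb, rfl⟩
  exact hN a b hb

/-- For b ∈ I the correction −ε(b)dx in the commutation rule vanishes, so right multiplication only
moves `b` inside the right ideal. -/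
theorem formsOf_bimodule (hI : IsAdIdeal I) (hε : ∀ a ∈ I, Coalgebra.counit (R := k) a = 0)
    (a : Bicrossproduct k h) (η : Ω) (hη : η ∈ Γ.formsOf I) :
    a • η ∈ Γ.formsOf I ∧ MulOpposite.op a • η ∈ Γ.formsOf I := by
  refine ⟨formsOf_le (N := (Γ.formsOf I).comap (leftMulForm k _ Ω a)) (fun c b hb => ?_) hη,
    formsOf_le (N := (Γ.formsOf I).comap (rightMulForm k _ Ω a)) (fun c b hb => ?_) hη⟩
  · rw [Submodule.mem_comap, leftMulForm_apply, smul_smul]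
    exact smul_mem_formsOf _ hb
  · rw [Submodule.mem_comap, rightMulForm_apply, ← smul_comm]
    induction a using ind with
    | ha a b ha hb => rw [MulOpposite.op_add, add_smul, smul_add]; exact add_mem ha hb
    | hs r a ha =>
      rw [MulOpposite.op_smul, smul_assoc, smul_comm]
      exact Submodule.smul_mem _ _ ha
    | hd t w =>
      rw [op_smul_maurerCartan, hε b hb, zero_smul, sub_zero, Finset.smul_sum]
      refine sum_mem fun d _ => ?_
      rw [smul_smul]
      exact smul_mem_formsOf _ (hI.mul_mem b hb d w)

theorem formsOf_bicomodule [Fintype G] (hI : IsAdIdeal I) (η : Ω) (hη : η ∈ Γ.formsOf I) :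
    Γ.coactL η ∈ LinearMap.range ((Γ.formsOf I).subtype.lTensor (Bicrossproduct k h)) ∧
      Γ.coactR η ∈ LinearMap.range ((Γ.formsOf I).subtype.rTensor (Bicrossproduct k h)) := by
  refine ⟨formsOf_le (N := Submodule.comap Γ.coactL (LinearMap.range
      ((Γ.formsOf I).subtype.lTensor (Bicrossproduct k h)))) (fun a b hb => ?_) hη,
    formsOf_le (N := Submodule.comap Γ.coactR (LinearMap.range
      ((Γ.formsOf I).subtype.rTensor (Bicrossproduct k h)))) (fun a b hb => ?_) hη⟩
  · have h1 : Γ.coactL (Γ.maurerCartan b) = 1 ⊗ₜ Γ.maurerCartan b :=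
      sub_eq_zero.mp (Γ.maurerCartan_mem b)
    rw [Submodule.mem_comap, coactL_left, h1]
    generalize (Coalgebra.comul a : Bicrossproduct k h ⊗[k] Bicrossproduct k h) = t
    induction t with
    | zero => simp
    | add s t hs ht => rw [map_add, LinearMap.add_apply]; exact add_mem hs ht
    | tmul x y =>
      exact ⟨x ⊗ₜ ⟨_, smul_mem_formsOf y hb⟩, by simp [leftMulForm_apply]⟩
  · rw [Submodule.mem_comap, coactR_left, coactR_maurerCartan]
    generalize (Coalgebra.comul a : Bicrossproduct k h ⊗[k] Bicrossproduct k h) = t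
    induction t with
    | zero => simp
    | add s t hs ht => rw [map_add, LinearMap.add_apply]; exact add_mem hs ht
    | tmul x y =>
      simp only [map_sum]
      refine sum_mem fun r _ => sum_mem fun w _ => ?_
      exact ⟨⟨_, smul_mem_formsOf x (hI.adjointCoeff_mem b hb r w)⟩ ⊗ₜ (y * delta r w),
        by simp [leftMulForm_apply]⟩

/-- For an irreducible calculus the ideal of relations is maximal among the `Ad`-stable right
ideals contained in `ker ε`. -/
theorem IsIrreducible.le_or_ge [Fintype G] (hΓ : Γ.IsIrreducible) (hI : IsAdIdeal I)
    (hε : ∀ a ∈ I, Coalgebra.counit (R := k) a = 0) (hle : Γ.relations ≤ I) :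
    I ≤ Γ.relations ∨ ∀ a : Bicrossproduct k h, Coalgebra.counit (R := k) a = 0 → a ∈ I := by
  rcases hΓ.2 (Γ.formsOf I) (formsOf_bimodule hI hε) (formsOf_bicomodule hI) with e | e
  · refine Or.inl fun b hb => ⟨hε b hb, ?_⟩
    have := smul_mem_formsOf (Γ := Γ) 1 hb
    rwa [e, Submodule.mem_bot, one_smul] at this
  · refine Or.inr fun a ha => ?_
    -- The invariant projection sends cω(b) to ε(c)ω(b), so ω(a) = ω(b) for some b ∈ I; then a − b
    -- is a relation and lies in I.
    have hi : Γ.formsOf I ≤ (I.map Γ.maurerCartan).comap Γ.invariantProj := by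
      refine formsOf_le fun c b hb => ?_
      rw [Submodule.mem_comap, Γ.invariantProj_smul c (Γ.maurerCartan_mem b)]
      exact Submodule.smul_mem _ _ (Submodule.mem_map_of_mem hb)
    obtain ⟨b, hb, e'⟩ := hi (e ▸ Submodule.mem_top : Γ.maurerCartan a ∈ _)
    rw [Γ.invariantProj_of_mem (Γ.maurerCartan_mem a)] at e'
    have : a - b ∈ I := hle ⟨by simp [ha, hε b hb], by simp [e']⟩
    simpa using add_mem this hb

/-- A basis of the tangent space has a dual basis of left-invariant forms. -/
theorem exists_isDualBasis {ι : Type*} [Fintype ι]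
    {φ : ι → Module.Dual k (Bicrossproduct k h)} (hli : LinearIndependent k φ)
    (hsp : Submodule.span k (Set.range φ) = Γ.tangentSpace) : ∃ e : ι → Ω, Γ.IsDualBasis φ e := by
  set Φ : Bicrossproduct k h →ₗ[k] ι → k := LinearMap.pi φ with hΦ
  -- Since `φ` spans the annihilator of ker ω, the maps `Φ` and ω have the same kernel. The dual
  -- basis consists of the values of ω at preimages of unit vectors.
  have hker : ∀ x, Φ x = 0 → Γ.maurerCartan x = 0 := by
    intro x hx
    rw [← LinearMap.mem_ker, ← Subspace.dualAnnihilator_dualCoannihilator_eq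
      (W := LinearMap.ker Γ.maurerCartan), ← Γ.tangentSpace_eq, ← hsp,
      Submodule.mem_dualCoannihilator]
    intro ψ hψ
    refine (Submodule.span_le (p := LinearMap.ker (Module.Dual.eval k _ x))).mpr ?_ hψ
    rintro _ ⟨a, rfl⟩
    exact congrFun hx a
  have hker' : ∀ x, Γ.maurerCartan x = 0 → Φ x = 0 := by
    intro x hx
    ext a
    have ha : φ a ∈ Γ.tangentSpace := hsp ▸ Submodule.subset_span (Set.mem_range_self a)
    rw [Γ.tangentSpace_eq, Submodule.mem_dualAnnihilator] at ha
    exact ha x hx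
  have hsurj : Function.Surjective Φ := by
    rw [← LinearMap.range_eq_top]
    by_contra hlt
    obtain ⟨f, hf, hle⟩ := Submodule.exists_le_ker_of_lt_top _ (lt_top_iff_ne_top.mpr hlt)
    -- A functional vanishing on the range of `Φ` is a linear relation among the `φ a`.
    have h0 : ∑ a, f (fun j => if a = j then 1 else 0) • φ a = 0 := by
      ext y
      have h1 : f (Φ y) = 0 := hle ⟨y, rfl⟩
      rw [LinearMap.pi_apply_eq_sum_univ] at h1
      rw [LinearMap.sum_apply]
      refine Eq.trans ?_ h1
      exact Finset.sum_congr rfl fun a _ => mul_comm _ _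
    have h2 := Fintype.linearIndependent_iff.mp hli _ h0
    refine hf (LinearMap.ext fun c => ?_)
    rw [LinearMap.pi_apply_eq_sum_univ]
    exact Finset.sum_eq_zero fun a _ => by rw [h2 a, smul_zero]
  choose x hx using fun a => hsurj (Pi.single a 1)
  have hxa : ∀ c : ι → k, Φ (∑ a, c a • x a) = c := by
    intro c
    rw [map_sum]
    simp only [map_smul, hx]
    ext b
    simp [Finset.sum_apply, Pi.single_apply]
  have hdual : ∀ y, Γ.maurerCartan y = ∑ a, φ a y • Γ.maurerCartan (x a) := by
    intro y
    have := hker (y - ∑ a, φ a y • x a) (by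
      rw [map_sub, hxa, sub_eq_zero]
      rfl)
    rw [map_sub, sub_eq_zero] at this
    rw [this]
    simp
  refine ⟨fun a => Γ.maurerCartan (x a), ?_, ?_, hdual⟩
  · rw [Fintype.linearIndependent_iff]
    intro c hc a
    have := hker' (∑ a, c a • x a) (by simpa using hc)
    rw [hxa] at this
    exact congrFun this a
  · rw [← range_maurerCartan]
    refine le_antisymm (Submodule.span_le.mpr ?_) ?_
    · rintro _ ⟨a, rfl⟩
      exact ⟨_, rfl⟩
    · rintro _ ⟨y, rfl⟩
      rw [hdual y]
      exact sum_mem fun a _ => Submodule.smul_mem _ _ (Submodule.subset_span ⟨a, rfl⟩)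

end BicovariantCalculus

end AdIdeals

/-! ### Crossed submodules of `kX` as Ad-stable right ideals, and the vector σ. -/

noncomputable section Correspondence

open scoped Classical

open Bicrossproduct

namespace Bicross

variable {k : Type*} [Field k] {X : Type*} [Group X] {G M : Subgroup X}
  (h : G.IsComplement' M)

/-! ### The pairing of `kX` with itself -/

theorem toDual_delta (f : X →₀ k) (s : M) (u : G) :
    toDual k h f (delta s u) = f ((u : X) * s) := by
  induction f using Finsupp.induction_linear with
  | zero => simp
  | add f g hf hg => rw [map_add, LinearMap.add_apply, hf, hg, Finsupp.add_apply]
  | single x c =>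
    rw [toDual, Finsupp.linearCombination_single, LinearMap.smul_apply, coeff_delta,
      Finsupp.single_apply]
    have : (s = mFactor h x ∧ u = gFactor h x) ↔ x = (u : X) * s := by
      constructor
      · rintro ⟨rfl, rfl⟩
        exact (factor_mul h x).symm
      · rintro rfl
        exact ⟨(mFactor_mul h u s).symm, (gFactor_mul h u s).symm⟩
    simp [this]

theorem toDual_injective : Function.Injective (toDual k h) := by
  rw [injective_iff_map_eq_zero]
  intro f hf
  ext x
  have := toDual_delta h f (mFactor h x) (gFactor h x)
  rw [hf, factor_mul] at this
  exact this.symm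

theorem toDual_surjective [Finite X] : Function.Surjective (toDual k h) := by
  intro φ
  refine ⟨Finsupp.equivFunOnFinite.symm fun x => φ (delta (mFactor h x) (gFactor h x)),
    hom_ext fun s u => ?_⟩
  rw [toDual_delta]
  simp [gFactor_mul, mFactor_mul]

variable (k) in
/-- The identification `us ↦ δ_s ⊗ u` of `kX` with the bicrossproduct. -/
def toBicross : (X →₀ k) →ₗ[k] Bicrossproduct k h :=
  Finsupp.linearCombination k fun x => delta (mFactor h x) (gFactor h x)

theorem toBicross_single (u : G) (s : M) (c : k) :
    toBicross k h (Finsupp.single ((u : X) * s) c) = c • delta s u := by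
  rw [toBicross, Finsupp.linearCombination_single, gFactor_mul, mFactor_mul]

theorem toBicross_surjective : Function.Surjective (toBicross k h) := by
  intro a
  induction a using ind with
  | hd s u => exact ⟨Finsupp.single ((u : X) * s) 1, by rw [toBicross_single, one_smul]⟩
  | ha a b ha hb =>
    obtain ⟨f, rfl⟩ := ha
    obtain ⟨g, rfl⟩ := hb
    exact ⟨f + g, map_add _ _ _⟩
  | hs c a ha =>
    obtain ⟨f, rfl⟩ := ha
    exact ⟨c • f, map_smul _ _ _⟩

variable (k) in
/-- The bilinear form on `kX` for which the elements of `X` are orthonormal. -/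
def pairing : LinearMap.BilinForm k (X →₀ k) := (toDual k h).compl₂ (toBicross k h)

theorem pairing_apply (f g : X →₀ k) : pairing k h f g = toDual k h f (toBicross k h g) := rfl

theorem pairing_single (f : X →₀ k) (x : X) (c : k) :
    pairing k h f (Finsupp.single x c) = c * f x := by
  nth_rewrite 1 [← factor_mul h x]
  rw [pairing_apply, toBicross_single, map_smul, toDual_delta, factor_mul, smul_eq_mul]

theorem pairing_comm (f g : X →₀ k) : pairing k h f g = pairing k h g f := by
  induction g using Finsupp.induction_linear with
  | zero => simp
  | add g g' hg hg' => rw [map_add, hg, hg', map_add, LinearMap.add_apply]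
  | single y d =>
    induction f using Finsupp.induction_linear with
    | zero => simp
    | add f f' hf hf' => rw [map_add, LinearMap.add_apply, hf, hf', map_add]
    | single x c =>
      rw [pairing_single, pairing_single, Finsupp.single_apply, Finsupp.single_apply]
      by_cases e : x = y
      · simp [e, mul_comm]
      · simp [e, Ne.symm e]

theorem isRefl_pairing : (pairing k h).IsRefl := fun f g e => by
  rw [pairing_comm]
  exact e

theorem eq_zero_of_pairing (f : X →₀ k) (hf : ∀ g, pairing k h f g = 0) : f = 0 := by
  ext x
  have := hf (Finsupp.single x 1)
  rwa [pairing_single, one_mul] at this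

theorem nondegenerate_pairing : (pairing k h).Nondegenerate :=
  ⟨fun f hf => eq_zero_of_pairing h f hf,
    fun f hf => eq_zero_of_pairing h f fun g => (pairing_comm h f g).trans (hf g)⟩

theorem pairing_linAct (y : X) (f g : X →₀ k) :
    pairing k h f (linAct k h y g) = pairing k h (linAct k h y⁻¹ f) g := by
  induction g using Finsupp.induction_linear with
  | zero => simp
  | add g g' hg hg' => rw [map_add, map_add, hg, hg', map_add]
  | single x c =>
    rw [linAct_single, pairing_single, pairing_single]
    conv_rhs => rw [← rightAct_one h x, ← mul_inv_cancel y, rightAct_mul, linAct_apply_rightAct]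

theorem pairing_degreeProj (p : X → Prop) (f g : X →₀ k) :
    pairing k h f (degreeProj k h p g) = pairing k h (degreeProj k h p f) g := by
  induction g using Finsupp.induction_linear with
  | zero => simp
  | add g g' hg hg' => rw [map_add, map_add, hg, hg', map_add]
  | single x c =>
    rw [degreeProj_single, pairing_single, degreeProj_apply]
    split_ifs <;> simp [pairing_single]

theorem toBicross_injective : Function.Injective (toBicross k h) := by
  rw [injective_iff_map_eq_zero]
  intro f hf
  refine eq_zero_of_pairing h f fun g => ?_
  rw [pairing_comm, pairing_apply, hf, map_zero]

variable {h} in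
-- The adjoint of the action of y is that of y⁻¹, and degree projections are self-adjoint.
theorem IsCrossed.orthogonal {W : Submodule k (X →₀ k)} (hW : IsCrossed h W) :
    IsCrossed h ((pairing k h).orthogonal W) where
  linAct_mem y f hf g hg := by
    change pairing k h g _ = 0
    rw [pairing_linAct]
    exact hf _ (hW.linAct_mem _ g hg)
  mProj_mem s f hf g hg := by
    change pairing k h g _ = 0
    rw [pairing_degreeProj]
    exact hf _ (hW.mProj_mem _ g hg)
  gProj_mem u f hf g hg := by
    change pairing k h g _ = 0
    rw [pairing_degreeProj]
    exact hf _ (hW.gProj_mem _ g hg)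

/-! ### Crossed submodules and `Ad`-stable right ideals -/

/-- The condition s ◁ u = c in the product selects inverse degrees with M-factor `c`; what remains
is right translation of the G-part by `w`. -/
theorem toBicross_mul_delta (f : X →₀ k) (c : M) (w : G) :
    toBicross k h f * delta c w =
      toBicross k h (linAct k h w (degreeProj k h (fun z => mFactor h z⁻¹ = c) f)) := by
  induction f using Finsupp.induction_linear with
  | zero => simp [zero_mul']
  | add f g hf hg => rw [map_add, add_mul', hf, hg, map_add, map_add, map_add]
  | single x r =>
    rw [← factor_mul h x, degreeProj_single, toBicross_single, Bicrossproduct.smul_mul',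
      delta_mul_delta, mFactor_norm_inv]
    split_ifs
    · rw [linAct_single, rightAct_mul_coe, toBicross_single]
    · simp

section

variable [Fintype M]

theorem adjointCoeff_toBicross (f : X →₀ k) (r : M) (w : G) :
    adjointCoeff r w (toBicross k h f) =
      toBicross k h (linAct k h ((ract h r w)⁻¹ : M)
        (degreeProj k h (fun z => gFactor h z⁻¹ = w⁻¹) f)) := by
  induction f using Finsupp.induction_linear with
  | zero => simp
  | add f g hf hg => rw [map_add, map_add, hf, hg, map_add, map_add, map_add]
  | single x c =>
    rw [← factor_mul h x, degreeProj_single, toBicross_single, map_smul, adjointCoeff, lift_delta,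
      gFactor_norm_inv]
    set u := gFactor h x
    set s := mFactor h x
    have e : (lact h s u)⁻¹ * u = w ↔ u⁻¹ * lact h s u = w⁻¹ := by
      rw [← inv_inj (b := w), mul_inv_rev, inv_inv]
    simp only [e]
    split_ifs with e'
    · have e2 : ract h (ract h r w) u⁻¹ = ract h r (lact h s u)⁻¹ := by
        rw [← (act_mul h _ _ _).2, ← e.mpr e', mul_inv_cancel_right]
      rw [linAct_single, rightAct_mul_coe_right, toBicross_single, inv_inv, e2]
    · simp

/-- Conversely, summing over `c` removes the degree condition and recovers the action of G from the
product. -/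
theorem toBicross_linAct_coe (f : X →₀ k) (w : G) :
    toBicross k h (linAct k h w f) = ∑ c : M, toBicross k h f * delta c w := by
  induction f using Finsupp.induction_linear with
  | zero => simp
  | add f g hf hg => simp only [map_add, hf, hg, add_mul', Finset.sum_add_distrib]
  | single x r =>
    rw [← factor_mul h x, linAct_single, rightAct_mul_coe, toBicross_single, toBicross_single]
    simp only [Bicrossproduct.smul_mul', delta_mul_delta, smul_ite, smul_zero, Finset.sum_ite_eq,
      Finset.mem_univ, if_true]

/-- For each basis vector one `w` contributes, and the index r = m⁻¹ ◁ w⁻¹ is chosen so that r ◁ w =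
m⁻¹; this recovers the action of M. -/
theorem toBicross_linAct_coe_right [Fintype G] (f : X →₀ k) (m : M) :
    toBicross k h (linAct k h m f) =
      ∑ w : G, adjointCoeff (ract h m⁻¹ w⁻¹) w (toBicross k h f) := by
  induction f using Finsupp.induction_linear with
  | zero => simp
  | add f g hf hg => simp only [map_add, hf, hg, Finset.sum_add_distrib]
  | single x c =>
    rw [← factor_mul h x, linAct_single, rightAct_mul_coe_right, toBicross_single,
      toBicross_single]
    simp only [map_smul, adjointCoeff, lift_delta, smul_ite, smul_zero, Finset.sum_ite_eq,
      Finset.mem_univ, if_true]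
    rw [← (act_mul h _ _ _).2]
    simp

variable {h}

theorem isCrossed_comap [Fintype G] {I : Submodule k (Bicrossproduct k h)} (hI : IsAdIdeal I) :
    IsCrossed h (I.comap (toBicross k h)) where
  linAct_mem y f hf := by
    rw [Submodule.mem_comap] at hf ⊢
    rw [← factor_mul h y, linAct_mul, toBicross_linAct_coe_right]
    refine sum_mem fun w _ => hI.adjointCoeff_mem _ ?_ _ _
    rw [toBicross_linAct_coe]
    exact sum_mem fun c _ => hI.mul_mem _ hf _ _
  mProj_mem s f hf := by
    have := hI.mul_mem _ hf s 1
    rwa [toBicross_mul_delta, Subgroup.coe_one, linAct_one] at this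
  gProj_mem u f hf := by
    -- At r = 1 the group element acting is 1, leaving the bare degree projection.
    have := hI.adjointCoeff_mem _ hf 1 u⁻¹
    rwa [adjointCoeff_toBicross, (one_act h _).2, inv_one, Subgroup.coe_one, linAct_one,
      inv_inv] at this

theorem IsCrossed.isAdIdeal_map {W : Submodule k (X →₀ k)} (hW : IsCrossed h W) :
    IsAdIdeal (W.map (toBicross k h)) where
  mul_mem := by
    rintro _ ⟨f, hf, rfl⟩ t w
    exact ⟨_, hW.linAct_mem _ _ (hW.mProj_mem t f hf), (toBicross_mul_delta h f t w).symm⟩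
  adjointCoeff_mem := by
    rintro _ ⟨f, hf, rfl⟩ r w
    exact ⟨_, hW.linAct_mem _ _ (hW.gProj_mem w⁻¹ f hf), (adjointCoeff_toBicross h f r w).symm⟩

theorem projPlus_apply (f : X →₀ k) :
    projPlus k h f = toDual k h f - toDual k h f 1 • Coalgebra.counit := by
  simp [projPlus]

end

/-! ### The invariant vector -/

variable {h} [Fintype G]

variable (k) in
/-- The vector `∑_{u ∈ G} u`, which corresponds to the unit `ε` of the dual of the
bicrossproduct and to the integral `∑ᵤ δ_e ⊗ u` in the bicrossproduct. -/
def invariantVector (_ : G.IsComplement' M) : X →₀ k := ∑ u : G, Finsupp.single (u : X) 1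

theorem invariantVector_apply (x : X) :
    invariantVector k h x = if norm h x = 1 then 1 else 0 := by
  rw [invariantVector, Finsupp.finsetSum_apply, norm_eq_one_iff]
  simp only [Finsupp.single_apply]
  split_ifs with e
  · have hx : (gFactor h x : X) = x := by
      conv_rhs => rw [← factor_mul h x, e, Subgroup.coe_one, mul_one]
    rw [Finset.sum_eq_single (gFactor h x)]
    · simp [hx]
    · intro u _ hu
      rw [if_neg]
      rintro rfl
      exact hu (gFactor_coe h u).symm
    · simp
  · refine Finset.sum_eq_zero fun u _ => if_neg ?_
    rintro rfl
    exact e (mFactor_coe h u)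

theorem toBicross_invariantVector :
    toBicross k h (invariantVector k h) = ∑ u : G, delta 1 u := by
  rw [invariantVector, map_sum]
  refine Finset.sum_congr rfl fun u _ => ?_
  simpa using toBicross_single h u 1 (1 : k)

/-- The vector is the indicator of degree 1, and X acts on degrees by conjugation. -/
theorem linAct_invariantVector (y : X) :
    linAct k h y (invariantVector k h) = invariantVector k h := by
  ext x
  have e : x = rightAct h (rightAct h x y⁻¹) y := by
    rw [← rightAct_mul, inv_mul_cancel, rightAct_one]
  conv_lhs => rw [e]
  rw [linAct_apply_rightAct, invariantVector_apply, invariantVector_apply, norm_rightAct]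
  have : y⁻¹⁻¹ * norm h x * y⁻¹ = 1 ↔ norm h x = 1 := by
    rw [inv_inv]
    exact conj_eq_one_iff
  simp only [this]

theorem invariantVector_mem_component : invariantVector k h ∈ component k h 1 := by
  rw [mem_component]
  intro x hx
  rw [invariantVector_apply] at hx
  by_contra e
  simp [e] at hx

theorem isCrossed_span_invariantVector :
    IsCrossed h (Submodule.span k {invariantVector k h}) := by
  have key (p : X → Prop) (f : X →₀ k) (hf : f ∈ Submodule.span k {invariantVector k h}) :
      degreeProj k h p f ∈ Submodule.span k {invariantVector k h} := by
    obtain ⟨c, rfl⟩ := Submodule.mem_span_singleton.mp hf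
    rw [map_smul]
    refine Submodule.smul_mem _ _ ?_
    by_cases hp : p 1
    · rw [degreeProj_of_pos h p hp invariantVector_mem_component]
      exact Submodule.mem_span_singleton_self _
    · rw [degreeProj_of_neg h p hp invariantVector_mem_component]
      exact zero_mem _
  refine ⟨fun y f hf => ?_, fun s => key _, fun u => key _⟩
  obtain ⟨c, rfl⟩ := Submodule.mem_span_singleton.mp hf
  rw [map_smul, linAct_invariantVector]
  exact hf

variable [Fintype M]

theorem toDual_invariantVector : toDual k h (invariantVector k h) = Coalgebra.counit := by
  refine hom_ext fun s u => ?_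
  rw [toDual_delta, counit_delta, invariantVector_apply, norm_eq_one_iff, mFactor_mul]
  congr

theorem pairing_invariantVector_self :
    pairing k h (invariantVector k h) (invariantVector k h) = Fintype.card G := by
  rw [pairing_apply, toDual_invariantVector, toBicross_invariantVector, map_sum]
  simp [counit_delta]

theorem projPlus_invariantVector : projPlus k h (invariantVector k h) = 0 := by
  rw [projPlus_apply, toDual_invariantVector]
  simp

/-- The kernel of Π is spanned by σ, because σ represents ε and `toDual` is injective. -/
theorem eq_smul_of_projPlus_eq_zero {f : X →₀ k} (hf : projPlus k h f = 0) :
    f = toDual k h f 1 • invariantVector k h := by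
  apply toDual_injective h
  rw [map_smul, toDual_invariantVector]
  rwa [projPlus_apply, sub_eq_zero] at hf

/-- The invariant vector is orthogonal to the crossed module induced by a classification datum,
unless `Π` kills the latter. -/
theorem IsClassificationDatum.pairing_eq_zero {z₀ : X} {M₀ : Submodule k (X →₀ k)}
    (hM : IsClassificationDatum h z₀ M₀) (hne : (induced h M₀).map (projPlus k h) ≠ ⊥)
    {f : X →₀ k} (hf : f ∈ induced h M₀) : pairing k h (invariantVector k h) f = 0 := by
  have hinv : ∀ y f, pairing k h (invariantVector k h) (linAct k h y f) =
      pairing k h (invariantVector k h) f := fun y f => by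
    rw [pairing_linAct, linAct_invariantVector]
  suffices H : ∀ f ∈ M₀, pairing k h (invariantVector k h) f = 0 from
    induced_le (W := LinearMap.ker (pairing k h (invariantVector k h))).mpr
      (fun y f hf => (hinv y f).trans (H f hf)) hf
  by_cases hz : z₀ = 1
  · subst hz
    have hcent : ∀ y : X, y ∈ Subgroup.centralizer ({1} : Set X) := fun y =>
      Subgroup.mem_centralizer_singleton_iff.mpr (by simp)
    rcases hM.irreducible (M₀ ⊓ LinearMap.ker (pairing k h (invariantVector k h))) inf_le_left
      (by
        rintro y hy _ ⟨f, hf, rfl⟩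
        exact ⟨hM.stable y hy (Submodule.mem_map_of_mem hf.1), (hinv y f).trans hf.2⟩) with e | e
    · refine absurd ?_ hne
      -- Differences of translates are orthogonal to σ, hence lie in the zero intersection.
      have hfix : ∀ f ∈ M₀, ∀ y, linAct k h y f = f := by
        intro f hf y
        have : linAct k h y f - f ∈ M₀ ⊓ LinearMap.ker (pairing k h (invariantVector k h)) :=
          ⟨sub_mem (hM.stable y (hcent y) (Submodule.mem_map_of_mem hf)) hf, by simp [hinv]⟩
        rw [e] at this
        exact sub_eq_zero.mp this
      rw [eq_bot_iff, Submodule.map_le_iff_le_comap]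
      refine induced_le.mpr fun y f hf => ?_
      rw [hfix f hf, Submodule.mem_comap, Submodule.mem_bot]
      -- Degree 1 means support in G, where G acts by right translation; a fixed vector is therefore
      -- constant there, and Π kills it.
      have hc : f = f 1 • invariantVector k h := by
        ext x
        rw [Finsupp.smul_apply, invariantVector_apply]
        split_ifs with hx
        · have hx' : rightAct h 1 x = x := by
            have h1 : (gFactor h x : X) = x := by
              conv_rhs => rw [← factor_mul h x, (norm_eq_one_iff h x).mp hx, Subgroup.coe_one,
                mul_one]
            have := rightAct_mul_coe h 1 1 (gFactor h x)
            simpa [h1] using this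
          have hfx := linAct_apply_rightAct h x 1 f
          rw [hx', hfix f hf] at hfx
          simp [hfx]
        · have : f x = 0 := by
            by_contra h0
            exact hx ((mem_component h).mp (hM.le hf) x h0)
          simpa using this
      rw [hc, map_smul, projPlus_invariantVector, smul_zero]
    · intro f hf
      rw [← e] at hf
      exact hf.2
  · intro f hf
    -- Distinct degrees are orthogonal.
    rw [← degreeProj_of_pos h (· = z₀) rfl (hM.le hf), pairing_degreeProj,
      degreeProj_of_neg h (· = z₀) (Ne.symm hz) invariantVector_mem_component, map_zero,
      LinearMap.zero_apply]

end Bicross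

end Correspondence

/-! ### The inner generating form and the existence of a datum. -/

noncomputable section Classification

open scoped Classical

open Bicross Bicrossproduct

variable {k : Type*} [Field k] {X : Type*} [Group X] {G M : Subgroup X} [Fintype M]
  {h : G.IsComplement' M} [Fintype G]

/-- `Π` maps a homogeneous basis of an induced crossed module to a basis of its image. -/
theorem Bicross.IsHomogeneousBasis.linearIndependent_projPlus [CharZero k] {z₀ : X}
    {M₀ : Submodule k (X →₀ k)} (hM : IsClassificationDatum h z₀ M₀)
    (hne : (induced h M₀).map (projPlus k h) ≠ ⊥) {ι : Type*} {f : ι → X →₀ k} {z : ι → X}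
    (hf : IsHomogeneousBasis h (induced h M₀) f z) :
    LinearIndependent k fun a => projPlus k h (f a) := by
  refine hf.linearIndependent.map (f := projPlus k h) ?_
  rw [hf.span_eq, Submodule.disjoint_def]
  intro g hg hg0
  -- A multiple of σ orthogonal to σ is zero, since ⟨σ,σ⟩ = |G| ≠ 0 in characteristic 0.
  have e := eq_smul_of_projPlus_eq_zero hg0
  have := hM.pairing_eq_zero hne hg
  rw [e, map_smul, pairing_invariantVector_self, smul_eq_mul, mul_eq_zero] at this
  rw [e, this.resolve_right (Nat.cast_ne_zero.mpr Fintype.card_ne_zero), zero_smul]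

omit [Fintype G] in
/-- The coefficient `⟨δ_{⟨f⟩}, f⟩` of a homogeneous vector is its value at `1`. -/
theorem Bicross.toDual_one_of_mem_component {f : X →₀ k} {z : X} (hf : f ∈ component k h z) :
    toDual k h f 1 = f (mDegree h z : X) := by
  rw [one_def, map_sum]
  simp only [toDual_delta, Subgroup.coe_one, one_mul]
  -- An element s of M has degree s⁻¹, so `z` permits only one term.
  refine Finset.sum_eq_single _ (fun s _ hs => ?_) (by simp)
  by_contra h0
  apply hs
  rw [mDegree, ← (mem_component h).mp hf s h0, norm_coe_right, inv_inv, mFactor_coe_right]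

/-- The integral property Λa = ε(a)Λ: σ is fixed by X and lives in degree 1. -/
theorem Bicross.toBicross_invariantVector_mul_delta (c : M) (w : G) :
    toBicross k h (invariantVector k h) * delta c w =
      if c = 1 then toBicross k h (invariantVector k h) else 0 := by
  have h1 : mFactor h (1⁻¹ : X) = 1 := by simpa using mFactor_coe h 1
  rw [toBicross_mul_delta]
  split_ifs with hc
  · rw [degreeProj_of_pos h _ (by rw [h1, hc]) invariantVector_mem_component,
      linAct_invariantVector]
  · rw [degreeProj_of_neg h _ (by rw [h1]; exact Ne.symm hc) invariantVector_mem_component,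
      map_zero, map_zero]

theorem Bicross.counit_toBicross_invariantVector :
    Coalgebra.counit (R := k) (toBicross k h (invariantVector k h)) = Fintype.card G := by
  rw [← toDual_invariantVector, ← pairing_apply, pairing_invariantVector_self]

namespace BicovariantCalculus

variable {Ω : Type*} [AddCommGroup Ω] [Module k Ω]
  [Module (Bicrossproduct k h) Ω] [Module (Bicrossproduct k h)ᵐᵒᵖ Ω]
  [SMulCommClass (Bicrossproduct k h) (Bicrossproduct k h)ᵐᵒᵖ Ω]
  [IsScalarTower k (Bicrossproduct k h) Ω] [IsScalarTower k (Bicrossproduct k h)ᵐᵒᵖ Ω]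
  {Γ : BicovariantCalculus k (Bicrossproduct k h) Ω}

/-- The form `ω(∑ᵤ δ_e ⊗ u)` of the integral generates the exterior derivative. -/
theorem op_smul_maurerCartan_invariantVector (x : Bicrossproduct k h) :
    MulOpposite.op x • Γ.maurerCartan (toBicross k h (invariantVector k h)) -
        x • Γ.maurerCartan (toBicross k h (invariantVector k h)) =
      -((Fintype.card G : k) • Γ.d x) := by
  set ω := Γ.maurerCartan (toBicross k h (invariantVector k h)) with hω
  induction x using ind with
  | ha a b ha hb =>
    rw [MulOpposite.op_add, add_smul, add_smul, map_add, smul_add, neg_add, ← ha, ← hb]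
    abel
  | hs c a ha =>
    rw [MulOpposite.op_smul, smul_assoc, smul_assoc, map_smul, smul_comm _ c, ← smul_neg, ← ha,
      smul_sub]
  | hd t w =>
    rw [hω, op_smul_maurerCartan, counit_toBicross_invariantVector]
    simp only [toBicross_invariantVector_mul_delta, apply_ite Γ.maurerCartan, map_zero, smul_ite,
      smul_zero, Finset.sum_ite_eq', Finset.mem_univ, if_true, inv_one, mul_one,
      (one_act h _).1]
    abel

/-- A calculus whose tangent space comes from a classification datum is inner. -/
theorem d_eq_commutator [CharZero k] [Nontrivial Ω] {z₀ : X} {M₀ : Submodule k (X →₀ k)}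
    (hM : IsClassificationDatum h z₀ M₀)
    (hL : (induced h M₀).map (projPlus k h) = Γ.tangentSpace) {ι : Type*} [Fintype ι]
    {f : ι → X →₀ k} {z : ι → X} (hf : IsHomogeneousBasis h (induced h M₀) f z) {e : ι → Ω}
    (he : Γ.IsDualBasis (fun a => projPlus k h (f a)) e) (x : Bicrossproduct k h) :
    Γ.d x = MulOpposite.op x • (∑ a, f a (mDegree h (z a) : X) • e a) -
      x • (∑ a, f a (mDegree h (z a) : X) • e a) := by
  have hcard : (Fintype.card G : k) ≠ 0 := Nat.cast_ne_zero.mpr Fintype.card_ne_zero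
  -- Evaluating Π(f_a) at Λ gives ⟨f_a, σ⟩ − f_a(1)ε(Λ). The first term is zero, ε(Λ) = |G|, and
  -- f_a(1) = c_a.
  have key : Γ.maurerCartan (toBicross k h (invariantVector k h)) =
      -((Fintype.card G : k) • ∑ a, f a (mDegree h (z a) : X) • e a) := by
    rw [he.dual, Finset.smul_sum, ← Finset.sum_neg_distrib]
    refine Finset.sum_congr rfl fun a _ => ?_
    have h1 : f a ∈ induced h M₀ := hf.span_eq ▸ Submodule.subset_span (Set.mem_range_self a)
    have h2 := hM.pairing_eq_zero (hL ▸ Γ.tangentSpace_ne_bot) h1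
    rw [pairing_comm, pairing_apply] at h2
    rw [projPlus_apply, LinearMap.sub_apply, h2, LinearMap.smul_apply,
      counit_toBicross_invariantVector, toDual_one_of_mem_component (hf.homogeneous a),
      smul_smul, ← neg_smul, smul_eq_mul, zero_sub, mul_comm]
  have := Γ.op_smul_maurerCartan_invariantVector x
  rw [key, smul_neg, smul_neg, smul_comm _ (Fintype.card G : k), smul_comm _ (Fintype.card G : k),
    sub_neg_eq_add, neg_add_eq_sub, ← smul_sub, ← smul_neg] at this
  have := smul_right_injective Ω hcard this
  rw [← neg_neg (Γ.d x), ← this]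
  abel

/-- The tangent space of an irreducible calculus comes from a classification datum. -/
theorem IsIrreducible.exists_isClassificationDatum [CharZero k] [Finite X]
    (hΓ : Γ.IsIrreducible) : ∃ (z₀ : X) (M₀ : Submodule k (X →₀ k)),
      IsClassificationDatum h z₀ M₀ ∧ (induced h M₀).map (projPlus k h) = Γ.tangentSpace := by
  have := hΓ.1
  have hcard : (Fintype.card G : k) ≠ 0 := Nat.cast_ne_zero.mpr Fintype.card_ne_zero
  have hself := pairing_invariantVector_self (k := k) (h := h)
  set σ := invariantVector k h with hσ
  have hperp : ∀ W : Submodule k (X →₀ k),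
      (pairing k h).orthogonal ((pairing k h).orthogonal W) = W := fun W =>
    LinearMap.BilinForm.orthogonal_orthogonal (nondegenerate_pairing h) (isRefl_pairing h) W
  have hmem : ∀ (V : Submodule k (X →₀ k)) (f : X →₀ k),
      f ∈ (pairing k h).orthogonal (V ⊔ Submodule.span k {σ}) ↔
        (∀ g ∈ V, pairing k h g f = 0) ∧ pairing k h σ f = 0 := by
    intro V f
    constructor
    · intro hf
      exact ⟨fun g hg => hf g (Submodule.mem_sup_left hg),
        hf σ (Submodule.mem_sup_right (Submodule.mem_span_singleton_self σ))⟩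
    · rintro ⟨h1, h2⟩ g hg
      obtain ⟨g₁, hg₁, g₂, hg₂, rfl⟩ := Submodule.mem_sup.mp hg
      obtain ⟨c, rfl⟩ := Submodule.mem_span_singleton.mp hg₂
      change pairing k h _ f = 0
      rw [map_add, LinearMap.add_apply, h1 g₁ hg₁, map_smul, LinearMap.smul_apply, h2, smul_zero,
        add_zero]
  have hcounit : ∀ f, pairing k h σ f = Coalgebra.counit (R := k) (toBicross k h f) := fun f => by
    rw [pairing_apply, hσ, toDual_invariantVector]
  set J := Γ.relations.comap (toBicross k h) with hJ
  have hJc : IsCrossed h J := isCrossed_comap Γ.isAdIdeal_relations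
  -- The tangent space consists of functionals modulo ε that kill the relations; `W` is its lift
  -- orthogonal to σ.
  set W := (pairing k h).orthogonal (J ⊔ Submodule.span k {σ}) with hW
  have hWc : IsCrossed h W := (hJc.sup isCrossed_span_invariantVector).orthogonal
  have hmap : W.map (projPlus k h) = Γ.tangentSpace := by
    ext φ
    constructor
    · rintro ⟨f, hf, rfl⟩
      rw [SetLike.mem_coe, hW, hmem] at hf
      refine ⟨by simp [projPlus_apply], fun a ha ha' => ?_⟩
      obtain ⟨g, rfl⟩ := toBicross_surjective h a
      have := hf.1 g ⟨ha, ha'⟩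
      rw [pairing_comm, pairing_apply] at this
      rw [projPlus_apply, LinearMap.sub_apply, this, LinearMap.smul_apply, ha, smul_zero, sub_zero]
    · rintro ⟨h1, h2⟩
      obtain ⟨f, rfl⟩ := toDual_surjective h φ
      -- Removing the σ-component leaves Π unchanged and achieves orthogonality to σ.
      refine ⟨f - (pairing k h σ f / Fintype.card G) • σ, ?_, ?_⟩
      · rw [SetLike.mem_coe, hW, hmem]
        constructor
        · intro g hg
          rw [map_sub, map_smul, pairing_comm h g σ, hcounit g, LinearMap.mem_ker.mp hg.1, smul_zero,
            sub_zero, pairing_comm, pairing_apply]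
          exact h2 _ hg.1 hg.2
        · rw [map_sub, map_smul, hself, smul_eq_mul, div_mul_cancel₀ _ hcard, sub_self]
      · rw [map_sub, map_smul, projPlus_invariantVector, smul_zero, sub_zero, projPlus_apply, h1,
          zero_smul, sub_zero]
  obtain ⟨z₀, M₀, hM, hi⟩ := hWc.exists_isClassificationDatum
    (by
      intro e
      rw [e, Submodule.map_bot] at hmap
      exact Γ.tangentSpace_ne_bot hmap.symm)
    (by
      intro V hV hVc
      -- A submodule V of `W` gives a larger ideal `J'` inside ker ε, to which maximality of the
      -- relations applies.
      set J' := (pairing k h).orthogonal (V ⊔ Submodule.span k {σ}) with hJ'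
      have hJ'c : IsCrossed h J' := (hVc.sup isCrossed_span_invariantVector).orthogonal
      have hVσ : ∀ f ∈ V, pairing k h σ f = 0 := fun f hf => ((hmem J f).mp (hV hf)).2
      have hscalar : ∀ (v : X →₀ k) (c : k), pairing k h σ v = 0 →
          pairing k h σ (v + c • σ) = 0 → c = 0 := by
        intro v c hv hc
        rw [map_add, map_smul, hv, hself, zero_add, smul_eq_mul] at hc
        exact (mul_eq_zero.mp hc).resolve_right hcard
      have hle : Γ.relations ≤ J'.map (toBicross k h) := by
        intro a ha
        obtain ⟨g, rfl⟩ := toBicross_surjective h a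
        refine Submodule.mem_map_of_mem ((hmem V g).mpr ⟨fun v hv => ?_, ?_⟩)
        · rw [pairing_comm]
          exact ((hmem J v).mp (hV hv)).1 g ha
        · rw [hcounit]
          exact ha.1
      have hε : ∀ a ∈ J'.map (toBicross k h), Coalgebra.counit (R := k) a = 0 := by
        rintro _ ⟨g, hg, rfl⟩
        rw [← hcounit]
        exact ((hmem V g).mp hg).2
      rcases hΓ.le_or_ge hJ'c.isAdIdeal_map hε hle with e | e
      · refine Or.inr (le_antisymm hV fun f hf => ?_)
        -- If J' ⊂ J, then W ⊂ J'^⊥ = V + kσ; orthogonality to σ leaves only V.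
        have hf' : f ∈ (pairing k h).orthogonal J' := fun g hg =>
          ((hmem J f).mp hf).1 g (e (Submodule.mem_map_of_mem hg))
        rw [hJ', hperp] at hf'
        obtain ⟨v, hv, w, hw, rfl⟩ := Submodule.mem_sup.mp hf'
        obtain ⟨c, rfl⟩ := Submodule.mem_span_singleton.mp hw
        rw [hscalar v c (hVσ v hv) ((hmem J _).mp hf).2, zero_smul, add_zero]
        exact hv
      · refine Or.inl (eq_bot_iff.mpr fun f hf => ?_)
        -- If J' is all of ker ε = σ^⊥, then V lies in σ^⊥⊥ = kσ and also in σ^⊥, so it is zero.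
        have hf' : f ∈ (pairing k h).orthogonal
            ((pairing k h).orthogonal (Submodule.span k {σ})) := by
          intro g hg
          have hg' : pairing k h σ g = 0 := hg σ (Submodule.mem_span_singleton_self σ)
          rw [hcounit] at hg'
          obtain ⟨g', hg₁, hg₂⟩ := e _ hg'
          rw [← toBicross_injective h hg₂]
          exact (pairing_comm h _ _).trans (((hmem V g').mp hg₁).1 f hf)
        rw [hperp] at hf'
        obtain ⟨c, rfl⟩ := Submodule.mem_span_singleton.mp hf'
        rw [hscalar 0 c (map_zero _) (by rw [zero_add]; exact hVσ _ hf), zero_smul]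
        exact zero_mem _)
  exact ⟨z₀, M₀, hM, hi ▸ hmap⟩

end BicovariantCalculus

end Classification

/-- Every irreducible bicovariant differential calculus on the bicrossproduct `k(M) ▶◁ kG` comes
from a classification datum `(z₀, M₀)`, and for each such datum and each homogeneous basis `f` of
the associated module (in particular `f_{iz} = f_i ◁̃ z̄`), the calculus is inner by the 1-form
`θ = ∑ₐ cₐ eₐ`, where `e` is the basis of left-invariant 1-forms dual to `f` and
`cₐ = ⟨δ_{⟨fₐ⟩}, fₐ⟩`. -/
theorem mainTheorem3 {k : Type*} [Field k] [CharZero k] {X : Type*} [Group X] [Finite X]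
    {G M : Subgroup X} [Fintype M] (h : G.IsComplement' M)
    {Ω : Type*} [AddCommGroup Ω] [Module k Ω] [Module (Bicrossproduct k h) Ω]
    [Module (Bicrossproduct k h)ᵐᵒᵖ Ω]
    [SMulCommClass (Bicrossproduct k h) (Bicrossproduct k h)ᵐᵒᵖ Ω]
    [IsScalarTower k (Bicrossproduct k h) Ω] [IsScalarTower k (Bicrossproduct k h)ᵐᵒᵖ Ω]
    (Γ : BicovariantCalculus k (Bicrossproduct k h) Ω) (hΓ : Γ.IsIrreducible) :
    (∃ (z₀ : X) (M₀ : Submodule k (X →₀ k)), Bicross.IsClassificationDatum h z₀ M₀ ∧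
      (Bicross.induced h M₀).map (Bicross.projPlus k h) = Γ.tangentSpace) ∧
    ∀ (z₀ : X) (M₀ : Submodule k (X →₀ k)), Bicross.IsClassificationDatum h z₀ M₀ →
      (Bicross.induced h M₀).map (Bicross.projPlus k h) = Γ.tangentSpace →
      (∀ (ι : Type*) (f₀ : ι → X →₀ k), LinearIndependent k f₀ →
        Submodule.span k (Set.range f₀) = M₀ →
        ∀ zbar : {z : X // IsConj z₀ z} → X, (∀ z, (zbar z)⁻¹ * z₀ * zbar z = z) →
          Bicross.IsHomogeneousBasis h (Bicross.induced h M₀)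
            (fun p : ι × {z : X // IsConj z₀ z} => Bicross.linAct k h (zbar p.2) (f₀ p.1))
            (fun p => p.2)) ∧
      ∀ (ι : Type*) [Fintype ι] (f : ι → X →₀ k) (z : ι → X),
        Bicross.IsHomogeneousBasis h (Bicross.induced h M₀) f z →
        (∃ e : ι → Ω, Γ.IsDualBasis (fun a => Bicross.projPlus k h (f a)) e) ∧
        ∀ e : ι → Ω, Γ.IsDualBasis (fun a => Bicross.projPlus k h (f a)) e →
          ∀ θ : Ω, θ = ∑ a, f a (Bicross.mDegree h (z a) : X) • e a →
            ∀ x : Bicrossproduct k h, Γ.d x = MulOpposite.op x • θ - x • θ := by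

  have := Fintype.ofFinite G
  have := hΓ.1
  refine ⟨hΓ.exists_isClassificationDatum, fun z₀ M₀ hM hL =>
    ⟨fun ι f₀ hli hsp zbar hz => hM.isHomogeneousBasis hli hsp zbar hz, fun ι _ f z hf => ⟨?_, ?_⟩⟩⟩
  · refine Γ.exists_isDualBasis
      (hf.linearIndependent_projPlus hM (hL ▸ Γ.tangentSpace_ne_bot)) ?_
    rw [← hL, ← hf.span_eq, Submodule.map_span, ← Set.range_comp]
    rfl
  · rintro e he θ rfl x
    exact Γ.d_eq_commutator hM hL hf he x
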